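/- **Setting.** Let $H$ be a real Hilbert space with inner product $(\cdot,\cdot)$, and let $A:D(A)\subset H\to H$ be a closed, densely defined, self-adjoint, positive definite linear operator with compact resolvent. Let $\lambda_1\le\lambda_2\le\cdots$ be the infinite sequence of the eigenvalues of $A$, repeated according to multiplicity, with corresponding orthonormal eigenvectors $\phi_1,\phi_2,\dots$ (those with $\lambda_n=\Lambda$ span the eigenspace of $\Lambda$). Let $B\in\mathcal L(H)$, $\delta>0$, and $\beta'+\delta\beta=0$, $\beta(0)=1$, on $\mathbb R$ (so $\beta(t)=e^{-\delta t}$). On the complexification $\tilde H=H+iH$ (norm $|\cdot|_{\tilde H}$, with $A$ and $B$ extended complex-linearly) consider $$y'(t)+Ay(t)+\int_0^t\beta(t-s)Ay(s)\,ds=Bu(t),\qquad y(0)=y_0. \tag{1}$$ A weak solution of (1) is a $y\in C([0,\infty);\tilde H)$ with $y(0)=y_0$ such that for all $\varphi\in D(A)+iD(A)$ and $t\ge0$ $$\frac{d}{dt}(y(t),\varphi)+(y(t),A\varphi)+\int_0^t\beta(t-s)(y(s),A\varphi)\,ds=(Bu(t),\varphi);$$ a classical solution is a $y\in C^1([0,\infty);\tilde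 H)\cap C([0,\infty);D(A)+iD(A))$ satisfying (1) in $\tilde H$ for all $t\ge 0$. Put $\mu_n^\pm=\frac12\big(\lambda_n+\delta\pm\sqrt{(\lambda_n-\delta)^2-4\lambda_n}\big)\in\mathbb C$, and assume $\delta\ne\lambda_j\pm2\sqrt{\lambda_j}$ for all $j$ and $\mu_j^+\ne\mu_m^-$ for all $j\ne m$. Let $0<\gamma<\omega_0:=\delta+1$ and $$N=\max\big\{\sup\{j:\operatorname{Re}\mu_j^+\le\gamma\},\ \sup\{j:\operatorname{Re}\mu_j^-\le\gamma\}\big\}\quad(\sup\emptyset=0).$$ Let $\lambda_1,\dots,\lambda_N$ consist of $l$ distinct values, with multiplicities $m_1,\dots,m_l$, and let $M=\max_k m_k$ ($M=0$ if $N=0$). Let $\phi_1^*,\dots,\phi_N^*\in D(A)$ be eigenvectors of $A$, $A\phi_j^*=\lambda_j\phi_j^*$, with $(\phi_i,\phi_j^*)=\delta_{ij}$. Let $A_N=\mathrm{diag}(\lambda_j+\delta)_{j\le N}$, $B_N=\mathrm{diag}(\lambda_j(1+\delta))_{j\le N}$, $C_{NM}=\big((B\phi_i^*,\phi_j^*)\big)_{j\le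 N,\,i\le M}$, $$P_{2N}=\begin{pmatrix}0&I_N\\-B_N&-A_N\end{pmatrix},\qquad Q_{2NM}=\begin{pmatrix}0\\C_{NM}\end{pmatrix},\qquad D_{2N}=\mathrm{diag}(-\mu_1^+,\dots,-\mu_N^+,-\mu_1^-,\dots,-\mu_N^-).$$ Let $R_{2N}$ be an invertible complex matrix with $P_{2N}=R_{2N}^{-1}D_{2N}R_{2N}$, and $\overline Q_{2NM}=R_{2N}Q_{2NM}$. For $k=1,\dots,l$ let $\overline Q_k$ (resp. $\overline Q_{k+l}$) be the block of the $M\times 2N$ matrix $\overline Q_{2NM}^{\,*}$ formed by the columns $j$ (resp. $N+j$), $1\le j\le N$, for which $\lambda_j$ is the $k$-th distinct eigenvalue. **Theorem (semisimple case).** Assume that the eigenvalues $-\mu_j^\pm$, $1\le j\le N$, of $P_{2N}$ are semisimple and that $$\operatorname{rank}\overline Q_k=\operatorname{rank}\overline Q_{k+l}=m_k,\qquad k=1,\dots,l.$$ Consider controllers of the form $u(t)=\sum_{i=1}^M\Phi_iv_i(t)$ with $\Phi_i=\phi_i^*$ and $v=(v_i)_{i\le M}:[0,\infty)\to\mathbb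 C^M$. Say that $u$ *stabilizes (1) with constant $C$* if (1) has exactly one weak solution $y$ on $[0,\infty)$, this $y$ is a classical solution whenever $y_0\in D(A)+iD(A)$, and $$|y(t)|_{\tilde H}\le Ce^{-\gamma t}|y_0|_{\tilde H},\qquad t\ge0.$$ 1. There is $C>0$ such that for every $y_0\in\tilde H$ there is a continuous $v$ on $[0,\infty)$ whose controller $u$ stabilizes (1) with constant $C$. 2. For every $T>0$ there is $C>0$ such that for every $y_0\in\tilde H$ there are $v,w:[0,\infty)\to\mathbb C^M$, continuous on $[0,T)$, with $w\in L^2(0,T;\mathbb C^M)$ and, for $i=1,\dots,M$, $$v_i(t)=-\int_t^T\beta(t-s)w_i(s)\,ds\ \ (0\le t<T),\qquad \int_0^T|w_i(t)|^2dt\le C|y_0|_{\tilde H}^2,\qquad v_i(t)=w_i(t)=0\ \ (t\ge T),$$ such that the controller $u$ stabilizes (1) with constant $C$. 3. There is $C>0$ such that for every $y_0\in\tilde H$ there is $v\in C^2([0,\infty);\mathbb C^M)$ with $$|v_j(t)|+|v_j'(t)|+|v_j''(t)|\le Ce^{-\gamma t}|y_0|_{\tilde H},\qquad t>0,\ j=1,\dots,M,$$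 such that the controller $u$ stabilizes (1) with constant $C$. -/

import Mathlib

open scoped InnerProductSpace

noncomputable section

/-! ## The complexification `H + iH` of a real Hilbert space -/

/-- The complexification `H + iH` of a real inner product space `H`; the pair `(x, y)` stands for
`x + iy`, and `|x + iy|² = |x|² + |y|²`. -/
def Complexification (H : Type*) : Type _ := WithLp 2 (H × H)

namespace Complexification

variable {H : Type*} [NormedAddCommGroup H] [InnerProductSpace ℝ H]

instance : NormedAddCommGroup (Complexification H) :=
  inferInstanceAs (NormedAddCommGroup (WithLp 2 (H × H)))

instance [CompleteSpace H] : CompleteSpace (Complexification H) :=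
  inferInstanceAs (CompleteSpace (WithLp 2 (H × H)))

/-- The vector `x + iy`. -/
def mk (x y : H) : Complexification H := WithLp.toLp 2 (x, y)

/-- The real part of a vector of `H + iH`. -/
def re (z : Complexification H) : H := (WithLp.ofLp z).1

/-- The imaginary part of a vector of `H + iH`. -/
def im (z : Complexification H) : H := (WithLp.ofLp z).2

@[simp] theorem re_mk (x y : H) : (mk x y).re = x := rfl
@[simp] theorem im_mk (x y : H) : (mk x y).im = y := rfl

@[ext] theorem ext {z w : Complexification H} (h₁ : z.re = w.re) (h₂ : z.im = w.im) : z = w :=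
  (WithLp.ofLp_injective 2) (Prod.ext h₁ h₂)

@[simp] theorem re_add (z w : Complexification H) : (z + w).re = z.re + w.re := rfl
@[simp] theorem im_add (z w : Complexification H) : (z + w).im = z.im + w.im := rfl
@[simp] theorem re_zero : (0 : Complexification H).re = 0 := rfl
@[simp] theorem im_zero : (0 : Complexification H).im = 0 := rfl

theorem norm_sq_eq (z : Complexification H) : ‖z‖ ^ 2 = ‖z.re‖ ^ 2 + ‖z.im‖ ^ 2 :=
  WithLp.prod_norm_sq_eq_of_L2 (α := H) (β := H) z

/-- `(a + ib)(x + iy) = (ax - by) + i(ay + bx)`. -/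
instance : SMul ℂ (Complexification H) :=
  ⟨fun c z => mk (c.re • z.re - c.im • z.im) (c.re • z.im + c.im • z.re)⟩

@[simp] theorem re_smul (c : ℂ) (z : Complexification H) :
    (c • z).re = c.re • z.re - c.im • z.im := rfl
@[simp] theorem im_smul (c : ℂ) (z : Complexification H) :
    (c • z).im = c.re • z.im + c.im • z.re := rfl

instance : Module ℂ (Complexification H) where
  one_smul z := by ext <;> simp
  mul_smul a b z := by
    ext <;> simp only [re_smul, im_smul, Complex.mul_re, Complex.mul_im] <;> module
  smul_zero a := by ext <;> simp
  smul_add a z w := by ext <;> simp <;> module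
  add_smul a b z := by ext <;> simp <;> module
  zero_smul z := by ext <;> simp

/-- The inner product of `H + iH`, conjugate linear in the first argument (Mathlib's convention):
the sesquilinear extension of the inner product of `H`. -/
instance : Inner ℂ (Complexification H) :=
  ⟨fun z w => ⟨⟪z.re, w.re⟫_ℝ + ⟪z.im, w.im⟫_ℝ, ⟪z.re, w.im⟫_ℝ - ⟪z.im, w.re⟫_ℝ⟩⟩

theorem inner_def (z w : Complexification H) :
    ⟪z, w⟫_ℂ = ⟨⟪z.re, w.re⟫_ℝ + ⟪z.im, w.im⟫_ℝ, ⟪z.re, w.im⟫_ℝ - ⟪z.im, w.re⟫_ℝ⟩ := rfl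

theorem norm_smul_sq (c : ℂ) (z : Complexification H) : ‖c • z‖ ^ 2 = (‖c‖ * ‖z‖) ^ 2 := by
  rw [mul_pow, norm_sq_eq, norm_sq_eq, re_smul, im_smul, norm_sub_sq_real, norm_add_sq_real,
    Complex.sq_norm, Complex.normSq_apply]
  simp only [norm_smul, real_inner_smul_left, real_inner_smul_right, mul_pow, Real.norm_eq_abs,
    sq_abs]
  rw [real_inner_comm z.re z.im]
  ring

instance : InnerProductSpace ℂ (Complexification H) where
  norm_smul_le c z :=
    le_of_eq ((sq_eq_sq₀ (norm_nonneg _) (by positivity)).1 (norm_smul_sq c z))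
  norm_sq_eq_re_inner z := by
    rw [inner_def, norm_sq_eq]
    simp
  conj_inner_symm z w := by
    apply Complex.ext <;> simp [inner_def, real_inner_comm]
  add_left z w u := by
    apply Complex.ext <;> simp [inner_def, inner_add_left] <;> ring
  smul_left z w c := by
    apply Complex.ext <;>
      simp [inner_def, inner_add_left, inner_sub_left, real_inner_smul_left] <;> ring

/-- The inclusion `x ↦ x + i0` of `H` into `H + iH`. -/
def ofReal (x : H) : Complexification H := mk x 0

/-- The complex-linear extension `B (x + iy) = B x + i B y` of an operator on `H`. -/
def mapCLM (B : H →L[ℝ] H) (z : Complexification H) : Complexification H :=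
  mk (B z.re) (B z.im)

/-- The complex-linear extension of an unbounded operator `A` on `H`: its domain is
`D(A) + iD(A)` and `A (x + iy) = A x + i A y`. -/
def mapPMap (A : H →ₗ.[ℝ] H) : Complexification H →ₗ.[ℂ] Complexification H where
  domain :=
    { carrier := {z | z.re ∈ A.domain ∧ z.im ∈ A.domain}
      add_mem' := fun hz hw => ⟨A.domain.add_mem hz.1 hw.1, A.domain.add_mem hz.2 hw.2⟩
      zero_mem' := ⟨A.domain.zero_mem, A.domain.zero_mem⟩
      smul_mem' := fun c _ hz =>
        ⟨A.domain.sub_mem (A.domain.smul_mem c.re hz.1) (A.domain.smul_mem c.im hz.2),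
          A.domain.add_mem (A.domain.smul_mem c.re hz.2) (A.domain.smul_mem c.im hz.1)⟩ }
  toFun :=
    { toFun := fun z => mk (A ⟨z.1.re, z.2.1⟩) (A ⟨z.1.im, z.2.2⟩)
      map_add' := fun z w =>
        ext (A.map_add ⟨z.1.re, z.2.1⟩ ⟨w.1.re, w.2.1⟩)
          (A.map_add ⟨z.1.im, z.2.2⟩ ⟨w.1.im, w.2.2⟩)
      map_smul' := fun c z => by
        have h₁ := A.map_sub (c.re • ⟨z.1.re, z.2.1⟩) (c.im • ⟨z.1.im, z.2.2⟩)
        have h₂ := A.map_add (c.re • ⟨z.1.im, z.2.2⟩) (c.im • ⟨z.1.re, z.2.1⟩)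
        rw [A.map_smul, A.map_smul] at h₁ h₂
        exact ext h₁ h₂ }

end Complexification

namespace PIDE

open Complexification

variable {H : Type*} [NormedAddCommGroup H] [InnerProductSpace ℝ H]

/-! ## The operator `A` and its eigenvalues -/

/-- `A` is positive definite: `(Ax, x) > 0` for all `0 ≠ x ∈ D(A)`. -/
def PositiveDefinite (A : H →ₗ.[ℝ] H) : Prop :=
  ∀ x : A.domain, (x : H) ≠ 0 → 0 < ⟪A x, (x : H)⟫_ℝ

/-- For some `z` in the resolvent set of `A` the resolvent `(zI - A)⁻¹` is a compact operator. -/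
def HasCompactResolvent (A : H →ₗ.[ℝ] H) : Prop :=
  ∃ (z : ℝ) (K : H →L[ℝ] H), IsCompactOperator K ∧
    (∀ x : H, ∃ hx : K x ∈ A.domain, z • K x - A ⟨K x, hx⟩ = x) ∧
    ∀ x : A.domain, K (z • (x : H) - A x) = x

/-- `x` lies in `D(A)` and `A x = Λ x`. -/
def IsEigenpair (A : H →ₗ.[ℝ] H) (Λ : ℝ) (x : H) : Prop :=
  ∃ hx : x ∈ A.domain, A ⟨x, hx⟩ = Λ • x

/-- `lam 0 ≤ lam 1 ≤ …` lists the eigenvalues of `A`, each repeated according to its multiplicity,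
and `φ 0, φ 1, …` are corresponding orthonormal eigenvectors: the `φ n` with `lam n = Λ` span the
whole eigenspace of `Λ`. -/
structure IsEigenSystem (A : H →ₗ.[ℝ] H) (lam : ℕ → ℝ) (φ : ℕ → H) : Prop where
  mono : Monotone lam
  orthonormal : Orthonormal ℝ φ
  eigen : ∀ n, IsEigenpair A (lam n) (φ n)
  complete : ∀ (Λ : ℝ) (x : H), IsEigenpair A Λ x → x ∈ Submodule.span ℝ (φ '' {n | lam n = Λ})

/-! ## The exponents `μ_n^±` and the number `N` -/

/-- A square root of the real number `d` in `ℂ`: it is `√d` if `d ≥ 0`, and `i √|d|` if `d < 0`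
(recall that `Real.sqrt` vanishes on negative numbers). -/
def complexSqrt (d : ℝ) : ℂ := (Real.sqrt d : ℂ) + Complex.I * (Real.sqrt (-d) : ℂ)

/-- `μ^+ = (Λ + δ + √((Λ - δ)² - 4Λ)) / 2`. -/
def muPlus (δ Λ : ℝ) : ℂ := ((Λ + δ : ℝ) + complexSqrt ((Λ - δ) ^ 2 - 4 * Λ)) / 2

/-- `μ^- = (Λ + δ - √((Λ - δ)² - 4Λ)) / 2`. -/
def muMinus (δ Λ : ℝ) : ℂ := ((Λ + δ : ℝ) - complexSqrt ((Λ - δ) ^ 2 - 4 * Λ)) / 2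

/-- `N = max (sup {j : Re μ_j^+ ≤ γ}) (sup {j : Re μ_j^- ≤ γ})`, where the eigenvalues are numbered
from `1` on, i.e. the `j`-th one is `lam (j - 1)`; the supremum of the empty set is `0`. -/
def unstableDim (δ γ : ℝ) (lam : ℕ → ℝ) : ℕ :=
  max (sSup {n : ℕ | ∃ j : ℕ, n = j + 1 ∧ (muPlus δ (lam j)).re ≤ γ})
    (sSup {n : ℕ | ∃ j : ℕ, n = j + 1 ∧ (muMinus δ (lam j)).re ≤ γ})

/-- The multiplicity of `Λ` among the first `N` eigenvalues. -/
def mult (lam : ℕ → ℝ) (N : ℕ) (Λ : ℝ) : ℕ := Nat.card {j : Fin N // lam j = Λ}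

/-- `M`, the largest multiplicity among the first `N` eigenvalues (`0` if `N = 0`). -/
def maxMult (lam : ℕ → ℝ) (N : ℕ) : ℕ := Finset.univ.sup fun k : Fin N => mult lam N (lam k)

/-! ## The matrices of the finite-dimensional part -/

/-- `P_{2N} = [0, I; -B_N, -A_N]`, where `A_N = diag (λ_j + δ)` and `B_N = diag (λ_j (1 + δ))`. -/
def matP (δ : ℝ) (lam : ℕ → ℝ) (N : ℕ) : Matrix (Fin N ⊕ Fin N) (Fin N ⊕ Fin N) ℂ :=
  Matrix.fromBlocks 0 1
    (-Matrix.diagonal fun j : Fin N => ((lam j * (1 + δ) : ℝ) : ℂ))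
    (-Matrix.diagonal fun j : Fin N => ((lam j + δ : ℝ) : ℂ))

/-- `D_{2N} = diag (-μ_1^+, …, -μ_N^+, -μ_1^-, …, -μ_N^-)`. -/
def matD (δ : ℝ) (lam : ℕ → ℝ) (N : ℕ) : Matrix (Fin N ⊕ Fin N) (Fin N ⊕ Fin N) ℂ :=
  Matrix.diagonal (Sum.elim (fun j : Fin N => -muPlus δ (lam j)) fun j : Fin N => -muMinus δ (lam j))

/-- `C_{NM} = ((B φ_i^*, φ_j^*))`, with row index `j ≤ N` and column index `i ≤ M`. -/
def matC (B : H →L[ℝ] H) (φs : ℕ → H) (N M : ℕ) : Matrix (Fin N) (Fin M) ℂ :=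
  Matrix.of fun j i => ((⟪B (φs i), φs j⟫_ℝ : ℝ) : ℂ)

/-- `Q_{2NM} = [0; C_{NM}]`. -/
def matQ (B : H →L[ℝ] H) (φs : ℕ → H) (N M : ℕ) : Matrix (Fin N ⊕ Fin N) (Fin M) ℂ :=
  Matrix.fromRows 0 (matC B φs N M)

/-- The block of a matrix with column set `Fin N ⊕ Fin N` formed by those columns `j` of its first
half for which `lam j = Λ`. -/
def blockPlus {M N : ℕ} (Q : Matrix (Fin M) (Fin N ⊕ Fin N) ℂ) (lam : ℕ → ℝ) (Λ : ℝ) :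
    Matrix (Fin M) {j : Fin N // lam j = Λ} ℂ :=
  Q.submatrix id fun j => Sum.inl j.1

/-- The block of a matrix with column set `Fin N ⊕ Fin N` formed by those columns `j` of its second
half for which `lam j = Λ`. -/
def blockMinus {M N : ℕ} (Q : Matrix (Fin M) (Fin N ⊕ Fin N) ℂ) (lam : ℕ → ℝ) (Λ : ℝ) :
    Matrix (Fin M) {j : Fin N // lam j = Λ} ℂ :=
  Q.submatrix id fun j => Sum.inr j.1

open Classical in
/-- The rank condition: for each eigenvalue `Λ` among the first `N` ones, of multiplicity `m`, the
blocks of `Q̄^* = (R Q)^*` belonging to `-μ^+` and to `-μ^-` both have rank `m`. -/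
def RankCondition (B : H →L[ℝ] H) (lam : ℕ → ℝ) (φs : ℕ → H) (N M : ℕ)
    (R : Matrix (Fin N ⊕ Fin N) (Fin N ⊕ Fin N) ℂ) : Prop :=
  ∀ k : Fin N,
    (blockPlus (R * matQ B φs N M).conjTranspose lam (lam k)).rank = mult lam N (lam k) ∧
    (blockMinus (R * matQ B φs N M).conjTranspose lam (lam k)).rank = mult lam N (lam k)

/-- The number `ν` is semisimple for `P`: the generalized eigenspace of `ν` is its eigenspace. -/
def SemisimpleAt {ι : Type*} [Fintype ι] [DecidableEq ι] (P : Matrix ι ι ℂ) (ν : ℂ) : Prop :=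
  Module.End.maxGenEigenspace (Matrix.toLin' P) ν = Module.End.eigenspace (Matrix.toLin' P) ν

/-! ## Solutions of `y' + A y + ∫₀ᵗ β(t-s) A y(s) ds = B u`, `y(0) = y₀` in `H + iH` -/

/-- The control `u(t) = ∑ i, v_i(t) Φ_i` with complex amplitudes `v_i`. -/
def control {M : ℕ} (Φ : Fin M → H) (v : ℝ → Fin M → ℂ) (t : ℝ) : Complexification H :=
  ∑ i, v t i • ofReal (Φ i)

/-- Weak solutions for arbitrary initial data: `y ∈ C([0,∞); H + iH)`, `y(0) = y₀`, and
`d/dt (y, φ) + (y, Aφ) + ∫₀ᵗ β(t-s) (y(s), Aφ) ds = (Bu, φ)` for all `φ ∈ D(A) + iD(A)`, `t ≥ 0`. -/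
structure IsWeakSolution (A : H →ₗ.[ℝ] H) (B : H →L[ℝ] H) (β : ℝ → ℝ)
    (u : ℝ → Complexification H) (y₀ : Complexification H) (y : ℝ → Complexification H) :
    Prop where
  cont : ContinuousOn y (Set.Ici 0)
  init : y 0 = y₀
  eqn : ∀ φ : (mapPMap A).domain, ∀ t : ℝ, 0 ≤ t →
    HasDerivWithinAt (fun s => ⟪(φ : Complexification H), y s⟫_ℂ)
      (⟪(φ : Complexification H), mapCLM B (u t)⟫_ℂ - ⟪mapPMap A φ, y t⟫_ℂ
        - ∫ s in (0 : ℝ)..t, (β (t - s) : ℂ) * ⟪mapPMap A φ, y s⟫_ℂ)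
      (Set.Ici 0) t

/-- Classical solutions: `y ∈ C¹([0,∞); H + iH) ∩ C([0,∞); D(A) + iD(A))` (the latter with the graph
norm), `y(0) = y₀`, and the equation holds in `H + iH` at every `t ≥ 0`. Here `z = A y`. -/
def IsClassicalSolution (A : H →ₗ.[ℝ] H) (B : H →L[ℝ] H) (β : ℝ → ℝ)
    (u : ℝ → Complexification H) (y₀ : Complexification H) (y : ℝ → Complexification H) : Prop :=
  y 0 = y₀ ∧ ContDiffOn ℝ 1 y (Set.Ici 0) ∧
    ∃ z : ℝ → Complexification H, ContinuousOn z (Set.Ici 0) ∧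
      ∀ t : ℝ, 0 ≤ t → (∃ ht : y t ∈ (mapPMap A).domain, z t = mapPMap A ⟨y t, ht⟩) ∧
        HasDerivWithinAt y
          (mapCLM B (u t) - z t - ∫ s in (0 : ℝ)..t, β (t - s) • z s) (Set.Ici 0) t

/-- The control `u` takes the initial state `y₀` to a trajectory that decays at the rate `γ`: the
equation has exactly one weak solution `y` on `[0,∞)`, it satisfies `|y(t)| ≤ C e^{-γt} |y₀|` for
`t ≥ 0`, and it is a classical solution if `y₀ ∈ D(A) + iD(A)`. -/
def Steers (A : H →ₗ.[ℝ] H) (B : H →L[ℝ] H) (β : ℝ → ℝ) (γ C : ℝ)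
    (y₀ : Complexification H) (u : ℝ → Complexification H) : Prop :=
  ∃ y : ℝ → Complexification H,
    IsWeakSolution A B β u y₀ y ∧
    (∀ y', IsWeakSolution A B β u y₀ y' → Set.EqOn y' y (Set.Ici 0)) ∧
    (y₀ ∈ (mapPMap A).domain → IsClassicalSolution A B β u y₀ y) ∧
    ∀ t : ℝ, 0 ≤ t → ‖y t‖ ≤ C * Real.exp (-γ * t) * ‖y₀‖

end PIDE

end

open PIDE

/-!
In the eigenbasis of `A` the equation decouples into scalar equations, one for each eigenvalue
`Λ`, whose solutions are combinations of `exp (-μ t)` for the two roots `μ` of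
`μ (μ - δ) = Λ (μ - 1 - δ)`. Only finitely many modes fail to decay at the rate `γ` by themselves;
let `a_j` be the initial coordinates of these. A force acting up to the time `T` annihilates the
`j`-th one from then on as soon as `∫₀ᵀ e^{μs} f_j(s) ds = -a_j` for both roots `μ`. Since `Λ` can
be recovered from `μ`, different eigenvalues have different exponents, and since the functionals
`θ ↦ ∫₀ᵀ e^{μs} θ(s) ds` are eigenvectors of the transpose of `θ ↦ θ'` for distinct eigenvalues,
they are linearly independent on the test functions in `(0, T)`: there is a test function whose
moments are `1` at the exponents of one prescribed eigenvalue and `0` at those of the others. The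
rank condition says that the control directions act onto each eigenspace separately, so combining
them with these time profiles solves the moment problem. The remaining modes are controlled by
their own decay, uniformly in `Λ` because `μ⁺ ~ Λ` while `μ⁻ → δ + 1` as `Λ → ∞`.
-/

open scoped ContDiff

noncomputable section

namespace PIDE

open Complexification

section SelfAdjoint

open Filter Topology

variable {𝕜 E ι : Type*} [RCLike 𝕜] [NormedAddCommGroup E] [InnerProductSpace 𝕜 E]

theorem eq_of_forall_inner_eq (b : HilbertBasis ι 𝕜 E) {x y : E}
    (h : ∀ i, ⟪b i, x⟫_𝕜 = ⟪b i, y⟫_𝕜) : x = y :=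
  b.repr.injective <| by ext i; simpa only [b.repr_apply_apply] using h i

theorem inner_comm_of_forall_inner_eq {b : HilbertBasis ι 𝕜 E} {lam : ι → ℝ} {x z x' z' : E}
    (hx' : ∀ i, ⟪b i, z'⟫_𝕜 = lam i * ⟪b i, x'⟫_𝕜) (hx : ∀ i, ⟪b i, z⟫_𝕜 = lam i * ⟪b i, x⟫_𝕜) :
    ⟪z', x⟫_𝕜 = ⟪x', z⟫_𝕜 := by
  rw [← b.tsum_inner_mul_inner z', ← b.tsum_inner_mul_inner x']
  refine tsum_congr fun i => ?_
  rw [← inner_conj_symm z', hx', hx, map_mul, RCLike.conj_ofReal, inner_conj_symm]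
  ring

theorem tendsto_inner_orthonormal_cofinite {b : ι → E} (hb : Orthonormal 𝕜 b) (x : E) :
    Tendsto (fun i => ⟪x, b i⟫_𝕜) cofinite (𝓝 0) := by
  have h := (hb.inner_products_summable x).tendsto_cofinite_zero.sqrt
  rw [tendsto_zero_iff_norm_tendsto_zero]
  simpa only [Real.sqrt_sq (norm_nonneg _), Real.sqrt_zero, norm_inner_symm] using h

variable {T : E →ₗ.[𝕜] E}

/-- `T` is the multiplication operator by `lam`, with its maximal domain, in the coordinates of the
Hilbert basis `b`. -/
def IsDiagonalIn (T : E →ₗ.[𝕜] E) (b : HilbertBasis ι 𝕜 E) (lam : ι → ℝ) : Prop :=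
  ∀ x z, (x, z) ∈ T.graph ↔ ∀ i, ⟪b i, z⟫_𝕜 = lam i * ⟪b i, x⟫_𝕜

theorem IsDiagonalIn.mem_graph {b : HilbertBasis ι 𝕜 E} {lam : ι → ℝ} (h : IsDiagonalIn T b lam)
    (i : ι) : (b i, (lam i : 𝕜) • b i) ∈ T.graph := by
  refine (h _ _).2 fun j => ?_
  rcases eq_or_ne j i with rfl | hji
  · rw [inner_smul_right]
  · rw [inner_smul_right, b.orthonormal.2 hji, mul_zero, mul_zero]

variable [CompleteSpace E]

/-- The images accumulate only at vectors orthogonal to themselves. -/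
theorem tendsto_isCompactOperator_orthonormal_cofinite {K : E →L[𝕜] E} (hK : IsCompactOperator K)
    {b : ι → E} (hb : Orthonormal 𝕜 b) : Tendsto (fun i => K (b i)) cofinite (𝓝 0) := by
  rw [tendsto_iff_ultrafilter]
  intro g hg
  obtain ⟨a, -, ha⟩ := (hK.isCompact_closure_image_closedBall 1).ultrafilter_le_nhds'
    (g.map fun i => K (b i)) (Ultrafilter.mem_map.2 (univ_mem' fun i =>
      subset_closure ⟨b i, by simp [hb.1 i], rfl⟩))
  have hlim : Tendsto (fun i => ⟪a, K (b i)⟫_𝕜) g (𝓝 ⟪a, a⟫_𝕜) :=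
    tendsto_const_nhds.inner ha
  have hzero : Tendsto (fun i => ⟪a, K (b i)⟫_𝕜) g (𝓝 0) := by
    simpa only [ContinuousLinearMap.adjoint_inner_left] using
      (tendsto_inner_orthonormal_cofinite hb (ContinuousLinearMap.adjoint K a)).mono_left hg
  rwa [← inner_self_eq_zero.1 (tendsto_nhds_unique hlim hzero)]

theorem mem_graph_iff_forall_inner_eq (hT : IsSelfAdjoint T) {x z : E} :
    (x, z) ∈ T.graph ↔ ∀ x' z', (x', z') ∈ T.graph → ⟪z', x⟫_𝕜 = ⟪x', z⟫_𝕜 := by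
  conv_lhs => rw [← LinearPMap.isSelfAdjoint_def.1 hT,
    LinearPMap.adjoint_graph_eq_graph_adjoint hT.dense_domain, Submodule.mem_adjoint_iff]
  simp only [sub_eq_zero]

theorem isDiagonalIn_of_isSelfAdjoint (hT : IsSelfAdjoint T) {b : HilbertBasis ι 𝕜 E}
    {lam : ι → ℝ} (hb : ∀ i, (b i, (lam i : 𝕜) • b i) ∈ T.graph) : IsDiagonalIn T b lam := by
  have hcoord {x z : E} (hxz : (x, z) ∈ T.graph) (i : ι) : ⟪b i, z⟫_𝕜 = lam i * ⟪b i, x⟫_𝕜 := by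
    rw [← (mem_graph_iff_forall_inner_eq hT).1 hxz _ _ (hb i), inner_smul_left, RCLike.conj_ofReal]
  exact fun x z => ⟨hcoord, fun h => (mem_graph_iff_forall_inner_eq hT).2
    fun x' z' hx' => inner_comm_of_forall_inner_eq (hcoord hx') h⟩

end SelfAdjoint

section Eigenbasis

open Filter Topology

variable {H : Type*} [NormedAddCommGroup H] [InnerProductSpace ℝ H] {A : H →ₗ.[ℝ] H}

theorem isEigenpair_iff_mem_graph {Λ : ℝ} {x : H} :
    IsEigenpair A Λ x ↔ (x, Λ • x) ∈ A.graph := by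
  simp [IsEigenpair, LinearPMap.mem_graph_iff]

theorem IsEigenpair.pos (hpos : PositiveDefinite A) {Λ : ℝ} {x : H} (hx : IsEigenpair A Λ x)
    (hx0 : x ≠ 0) : 0 < Λ := by
  obtain ⟨hd, hAx⟩ := hx
  have := hpos ⟨x, hd⟩ hx0
  rw [hAx, real_inner_smul_left] at this
  exact pos_of_mul_pos_left this real_inner_self_nonneg

theorem isEigenpair_of_resolvent {z κ : ℝ} {K : H →L[ℝ] H}
    (hK : ∀ x, (K x, z • K x - x) ∈ A.graph) {x : H} (hx : K x = κ • x) :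
    IsEigenpair A (z - κ⁻¹) x := by
  have h := hK x
  rw [hx] at h
  rw [isEigenpair_iff_mem_graph]
  rcases eq_or_ne κ 0 with rfl | hκ
  · have hx0 := A.graph_fst_eq_zero_snd h (zero_smul ℝ x)
    simp only [zero_smul, smul_zero, zero_sub, neg_eq_zero] at hx0
    simp [hx0]
  · convert A.graph.smul_mem κ⁻¹ h using 1
    rw [Prod.smul_mk, smul_sub, smul_comm z κ, inv_smul_smul₀ hκ, inv_smul_smul₀ hκ, sub_smul]

variable [CompleteSpace H]

theorem isSymmetric_resolvent (hA : IsSelfAdjoint A) {z : ℝ} {K : H →L[ℝ] H}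
    (hK : ∀ x, (K x, z • K x - x) ∈ A.graph) : (K : H →ₗ[ℝ] H).IsSymmetric := by
  intro x y
  have h := (mem_graph_iff_forall_inner_eq hA).1 (hK y) _ _ (hK x)
  rw [inner_sub_left, inner_sub_right, real_inner_smul_left, real_inner_smul_right] at h
  exact (sub_right_injective h).symm

namespace IsEigenSystem

variable {lam : ℕ → ℝ} {φ : ℕ → H}

theorem tendsto_atTop (hφ : IsEigenSystem A lam φ) (hcpt : HasCompactResolvent A) :
    Tendsto lam atTop atTop := by
  obtain ⟨z, K, hK, -, hKA⟩ := hcpt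
  have hKφ (n : ℕ) : (z - lam n) • K (φ n) = φ n := by
    obtain ⟨hd, hAφ⟩ := hφ.eigen n
    simpa only [hAφ, ← sub_smul, map_smul] using hKA ⟨φ n, hd⟩
  refine (tendsto_atTop_of_monotone hφ.mono).resolve_right fun ⟨l, hl⟩ => ?_
  have hK0 := tendsto_isCompactOperator_orthonormal_cofinite hK hφ.orthonormal
  rw [Nat.cofinite_eq_atTop] at hK0
  have hlim : Tendsto φ atTop (𝓝 0) := by
    simpa only [hKφ, smul_zero] using (hl.const_sub z).smul hK0
  simpa [hφ.orthonormal.1] using hlim.norm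

theorem orthogonal_eq_bot (hφ : IsEigenSystem A lam φ) (hA : IsSelfAdjoint A)
    (hcpt : HasCompactResolvent A) : (Submodule.span ℝ (Set.range φ))ᗮ = ⊥ := by
  obtain ⟨z, K, hK, hAK, -⟩ := hcpt
  have hgraph (x : H) : (K x, z • K x - x) ∈ A.graph := by
    obtain ⟨hd, hx⟩ := hAK x
    rw [← eq_sub_iff_add_eq.2 (sub_eq_iff_eq_add'.1 hx).symm]
    exact A.mem_graph ⟨K x, hd⟩
  rw [eq_bot_iff, ← ContinuousLinearMap.orthogonalComplement_iSup_eigenspaces_eq_bot (T := K) hK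
    (isSymmetric_resolvent hA hgraph)]
  refine Submodule.orthogonal_le (iSup_le fun κ x hx => ?_)
  exact Submodule.span_mono (Set.image_subset_range _ _)
    (hφ.complete _ x (isEigenpair_of_resolvent hgraph (Module.End.mem_eigenspace_iff.1 hx)))

/-- The eigenvectors of `A` as a Hilbert basis of `H`. -/
def basis (hφ : IsEigenSystem A lam φ) (hA : IsSelfAdjoint A) (hcpt : HasCompactResolvent A) :
    HilbertBasis ℕ ℝ H :=
  HilbertBasis.mkOfOrthogonalEqBot hφ.orthonormal (hφ.orthogonal_eq_bot hA hcpt)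

@[simp] theorem coe_basis (hφ : IsEigenSystem A lam φ) (hA : IsSelfAdjoint A)
    (hcpt : HasCompactResolvent A) : ⇑(hφ.basis hA hcpt) = φ :=
  HilbertBasis.coe_mkOfOrthogonalEqBot _ _

theorem isDiagonalIn_basis (hφ : IsEigenSystem A lam φ) (hA : IsSelfAdjoint A)
    (hcpt : HasCompactResolvent A) : IsDiagonalIn A (hφ.basis hA hcpt) lam :=
  isDiagonalIn_of_isSelfAdjoint hA fun n => by
    simpa using isEigenpair_iff_mem_graph.1 (hφ.eigen n)

end IsEigenSystem

end Eigenbasis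

section Complexify

variable {H ι : Type*} [NormedAddCommGroup H] [InnerProductSpace ℝ H]

theorem inner_ofReal (x : H) (z : Complexification H) :
    ⟪ofReal x, z⟫_ℂ = ⟨⟪x, z.re⟫_ℝ, ⟪x, z.im⟫_ℝ⟩ := by
  simp [inner_def, ofReal]

theorem orthonormal_ofReal {b : ι → H} (hb : Orthonormal ℝ b) :
    Orthonormal ℂ fun i => ofReal (b i) := by
  classical
  rw [orthonormal_iff_ite] at hb ⊢
  intro i j
  rw [inner_ofReal]
  apply Complex.ext <;> simp [ofReal, hb] <;> split_ifs <;> simp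

theorem mem_graph_mapPMap {A : H →ₗ.[ℝ] H} {x z : Complexification H} :
    (x, z) ∈ (mapPMap A).graph ↔ (x.re, z.re) ∈ A.graph ∧ (x.im, z.im) ∈ A.graph := by
  constructor
  · intro h
    obtain ⟨y, hy⟩ := (LinearPMap.mem_graph_iff' _).1 h
    obtain ⟨rfl, rfl⟩ := Prod.mk_inj.1 hy
    exact ⟨A.mem_graph ⟨y.1.re, y.2.1⟩, A.mem_graph ⟨y.1.im, y.2.2⟩⟩
  · rintro ⟨hre, him⟩
    have hx : x ∈ (Complexification.mapPMap A).domain :=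
      ⟨LinearPMap.mem_domain_of_mem_graph hre, LinearPMap.mem_domain_of_mem_graph him⟩
    rw [← LinearPMap.image_iff hx]
    have hre' := (LinearPMap.image_iff hx.1).2 hre
    have him' := (LinearPMap.image_iff hx.2).2 him
    exact Complexification.ext hre' him'

variable [CompleteSpace H]

/-- A Hilbert basis of `H`, seen as a Hilbert basis of `H + iH`. -/
def complexifyBasis (b : HilbertBasis ι ℝ H) : HilbertBasis ι ℂ (Complexification H) :=
  HilbertBasis.mkOfOrthogonalEqBot (orthonormal_ofReal b.orthonormal) <| by
    refine (Submodule.eq_bot_iff _).2 fun z hz => ?_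
    have hb (i : ι) : ⟪ofReal (b i), z⟫_ℂ = 0 :=
      (Submodule.mem_orthogonal _ _).1 hz _ (Submodule.subset_span ⟨i, rfl⟩)
    simp only [inner_ofReal, Complex.ext_iff, Complex.zero_re, Complex.zero_im] at hb
    exact Complexification.ext (eq_of_forall_inner_eq b fun i => by simp [(hb i).1])
      (eq_of_forall_inner_eq b fun i => by simp [(hb i).2])

@[simp] theorem complexifyBasis_apply (b : HilbertBasis ι ℝ H) (i : ι) :
    complexifyBasis b i = ofReal (b i) :=
  congrFun (HilbertBasis.coe_mkOfOrthogonalEqBot _ _) i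

theorem IsDiagonalIn.mapPMap {A : H →ₗ.[ℝ] H} {b : HilbertBasis ι ℝ H} {lam : ι → ℝ}
    (h : IsDiagonalIn A b lam) : IsDiagonalIn (mapPMap A) (complexifyBasis b) lam := by
  intro x z
  rw [mem_graph_mapPMap, h, h, ← forall_and]
  simp [inner_ofReal, Complex.ext_iff]

end Complexify

section Coordinates

open Filter Topology

variable {𝕜 E ι X : Type*} [RCLike 𝕜] [NormedAddCommGroup E] [InnerProductSpace 𝕜 E]
  [TopologicalSpace X] (b : HilbertBasis ι 𝕜 E)

theorem hasSum_sq_norm_inner (x : E) : HasSum (fun i => ‖⟪b i, x⟫_𝕜‖ ^ 2) (‖x‖ ^ 2) := by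
  have h := lp.hasSum_norm (p := 2) (by norm_num) (b.repr x)
  simpa only [ENNReal.toReal_ofNat, Real.rpow_ofNat, LinearIsometryEquiv.norm_map,
    b.repr_apply_apply] using h

theorem norm_sq_le_tsum {x : E} {d : ι → ℝ} (hd : Summable fun i => d i ^ 2)
    (h : ∀ i, ‖⟪b i, x⟫_𝕜‖ ≤ d i) : ‖x‖ ^ 2 ≤ ∑' i, d i ^ 2 :=
  hasSum_le (fun i => pow_le_pow_left₀ (norm_nonneg _) (h i) 2) (hasSum_sq_norm_inner b x) hd.hasSum

theorem exists_inner_eq {c : ι → 𝕜} (hc : Summable fun i => ‖c i‖ ^ 2) :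
    ∃ x : E, ∀ i, ⟪b i, x⟫_𝕜 = c i := by
  have hmem : Memℓp c 2 := by
    rw [memℓp_gen_iff (by norm_num)]
    simpa using hc
  refine ⟨b.repr.symm ⟨c, hmem⟩, fun i => ?_⟩
  rw [← b.repr_apply_apply, LinearIsometryEquiv.apply_symm_apply]

theorem continuousOn_of_continuousOn_inner {s : Set X} {y : X → E} {c : ι → ℝ}
    (hc : Summable fun i => c i ^ 2) (hy : ∀ i, ContinuousOn (fun t => ⟪b i, y t⟫_𝕜) s)
    (hle : ∀ i, ∀ t ∈ s, ‖⟪b i, y t⟫_𝕜‖ ≤ c i) : ContinuousOn y s := by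
  intro t ht
  have hlim : Tendsto (fun r => ∑' i, ‖⟪b i, y r - y t⟫_𝕜‖ ^ 2) (𝓝[s] t) (𝓝 (∑' _ : ι, 0)) := by
    refine tendsto_tsum_of_dominated_convergence (hc.mul_left 4) (fun i => ?_) ?_
    · simpa only [inner_sub_right, sub_self, norm_zero, ne_eq, OfNat.ofNat_ne_zero,
        not_false_eq_true, zero_pow] using
        (((hy i t ht).tendsto.sub_const ⟪b i, y t⟫_𝕜).norm.pow 2)
    · filter_upwards [self_mem_nhdsWithin] with r hr i
      rw [inner_sub_right, Real.norm_of_nonneg (sq_nonneg _)]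
      calc ‖⟪b i, y r⟫_𝕜 - ⟪b i, y t⟫_𝕜‖ ^ 2 ≤ (c i + c i) ^ 2 := by
            gcongr
            exact (norm_sub_le _ _).trans (add_le_add (hle i r hr) (hle i t ht))
        _ = 4 * c i ^ 2 := by ring
  simp only [(hasSum_sq_norm_inner b _).tsum_eq, tsum_zero] at hlim
  rw [ContinuousWithinAt, tendsto_iff_norm_sub_tendsto_zero]
  simpa only [Real.sqrt_sq (norm_nonneg _), Real.sqrt_zero] using hlim.sqrt

theorem exists_continuousOn_inner_eq {s : Set X} {Y : ι → X → 𝕜} {c : ι → ℝ}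
    (hc : Summable fun i => c i ^ 2) (hY : ∀ i, ContinuousOn (Y i) s)
    (hle : ∀ i, ∀ t ∈ s, ‖Y i t‖ ≤ c i) :
    ∃ y : X → E, ContinuousOn y s ∧ ∀ t ∈ s, ∀ i, ⟪b i, y t⟫_𝕜 = Y i t := by
  have hex (t : X) (ht : t ∈ s) : ∃ x : E, ∀ i, ⟪b i, x⟫_𝕜 = Y i t :=
    exists_inner_eq b <| hc.of_nonneg_of_le (fun i => by positivity) fun i =>
      pow_le_pow_left₀ (norm_nonneg _) (hle i t ht) 2
  choose! y hy using hex
  refine ⟨y, continuousOn_of_continuousOn_inner b hc (fun i => ?_) fun i t ht => ?_, hy⟩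
  · exact (hY i).congr fun t ht => hy t ht i
  · rw [hy t ht]
    exact hle i t ht

end Coordinates

section Moments

open MeasureTheory

theorem pi_surjective_of_linearIndependent {ι F V : Type*} [Finite ι] [Field F] [AddCommGroup V]
    [Module F V] {f : ι → V →ₗ[F] F} (hf : LinearIndependent F f) :
    Function.Surjective (LinearMap.pi f) := by
  have hspan := span_flip_eq_top_iff_linearIndependent.2 <|
    hf.map' (LinearMap.ltoFun F V F F) (LinearMap.ker_eq_bot.2 DFunLike.coe_injective)
  rw [← LinearMap.range_eq_top, ← hspan, ← (LinearMap.range (LinearMap.pi f)).span_eq]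
  rfl

theorem hasDerivAt_cexp_mul (ν : ℂ) (t : ℝ) :
    HasDerivAt (fun s : ℝ => Complex.exp (ν * s)) (ν * Complex.exp (ν * t)) t := by
  have h : HasDerivAt (fun s : ℝ => ν * (s : ℂ)) (ν * 1) t :=
    (Complex.ofRealCLM.hasDerivAt (x := t)).const_mul ν
  simpa [mul_comm] using h.cexp

/-- The space of smooth complex-valued functions with compact support in `(0, T)`, from which the
control amplitudes are taken. -/
def testFunctions (T : ℝ) : Submodule ℂ (ℝ → ℂ) where
  carrier := {θ | ContDiff ℝ ∞ θ ∧ tsupport θ ⊆ Set.Ioo 0 T}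
  add_mem' h₁ h₂ :=
    ⟨h₁.1.add h₂.1, (tsupport_add _ _).trans (Set.union_subset h₁.2 h₂.2)⟩
  zero_mem' := ⟨contDiff_const, tsupport_zero.trans_subset (Set.empty_subset _)⟩
  smul_mem' c θ h :=
    ⟨h.1.const_smul c, (closure_mono (Function.support_const_smul_subset c θ)).trans h.2⟩

namespace testFunctions

variable {T t : ℝ} {θ : ℝ → ℂ}

theorem contDiff (h : θ ∈ testFunctions T) : ContDiff ℝ ∞ θ := h.1

theorem continuous (h : θ ∈ testFunctions T) : Continuous θ := h.1.continuous

theorem hasDerivAt (h : θ ∈ testFunctions T) (t : ℝ) : HasDerivAt θ (deriv θ t) t :=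
  (h.1.differentiable (by simp) t).hasDerivAt

theorem eq_zero_of_notMem_Ioo (h : θ ∈ testFunctions T) (ht : t ∉ Set.Ioo 0 T) : θ t = 0 :=
  image_eq_zero_of_notMem_tsupport fun h' => ht (h.2 h')

theorem deriv_mem (h : θ ∈ testFunctions T) : deriv θ ∈ testFunctions T :=
  ⟨(contDiff_infty_iff_deriv.1 h.1).2, (tsupport_deriv_subset).trans h.2⟩

theorem exists_bound (h : θ ∈ testFunctions T) :
    ∃ C, 0 < C ∧ ∀ t, ‖θ t‖ ≤ C ∧ ‖deriv θ t‖ ≤ C ∧ ‖deriv (deriv θ) t‖ ≤ C := by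
  have hbdd {ϑ : ℝ → ℂ} (hϑ : ϑ ∈ testFunctions T) : ∃ C, ∀ t, ‖ϑ t‖ ≤ C :=
    (continuous hϑ).bounded_above_of_compact_support <|
      isCompact_Icc.of_isClosed_subset (isClosed_tsupport ϑ) (hϑ.2.trans Set.Ioo_subset_Icc_self)
  obtain ⟨C₀, h₀⟩ := hbdd h
  obtain ⟨C₁, h₁⟩ := hbdd (deriv_mem h)
  obtain ⟨C₂, h₂⟩ := hbdd (deriv_mem (deriv_mem h))
  refine ⟨max 1 (max C₀ (max C₁ C₂)), by positivity, fun t => ⟨(h₀ t).trans ?_, (h₁ t).trans ?_,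
    (h₂ t).trans ?_⟩⟩ <;> simp

end testFunctions

variable {T : ℝ}

/-- The moment `∫₀ᵀ e^{νs} θ(s) ds`, as a linear functional of `θ`. -/
def expMoment (T : ℝ) (ν : ℂ) : testFunctions T →ₗ[ℂ] ℂ where
  toFun θ := ∫ s in (0 : ℝ)..T, Complex.exp (ν * s) * θ.1 s
  map_add' θ₁ θ₂ := by
    have h₁ := testFunctions.continuous θ₁.2
    have h₂ := testFunctions.continuous θ₂.2
    rw [← intervalIntegral.integral_add (Continuous.intervalIntegrable (by fun_prop) _ _)
      (Continuous.intervalIntegrable (by fun_prop) _ _)]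
    simp only [Submodule.coe_add, Pi.add_apply, mul_add]
  map_smul' c θ := by
    rw [RingHom.id_apply, smul_eq_mul, ← intervalIntegral.integral_const_mul]
    simp only [Submodule.coe_smul, Pi.smul_apply, smul_eq_mul, mul_left_comm c]

theorem expMoment_apply (ν : ℂ) (θ : testFunctions T) :
    expMoment T ν θ = ∫ s in (0 : ℝ)..T, Complex.exp (ν * s) * θ.1 s := rfl

/-- Differentiation as an operator on `testFunctions T`. -/
def testDeriv (T : ℝ) : testFunctions T →ₗ[ℂ] testFunctions T where
  toFun θ := ⟨deriv θ.1, testFunctions.deriv_mem θ.2⟩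
  map_add' θ₁ θ₂ := Subtype.ext <| funext fun t =>
    ((testFunctions.hasDerivAt θ₁.2 t).add (testFunctions.hasDerivAt θ₂.2 t)).deriv
  map_smul' c θ := Subtype.ext <| funext fun t =>
    ((testFunctions.hasDerivAt θ.2 t).const_smul c).deriv

theorem expMoment_testDeriv (ν : ℂ) (θ : testFunctions T) :
    expMoment T ν (testDeriv T θ) = -ν * expMoment T ν θ := by
  have := testFunctions.continuous θ.2
  have hc' : Continuous (deriv θ.1) := testFunctions.continuous (testFunctions.deriv_mem θ.2)
  have hparts : ∫ s in (0 : ℝ)..T, Complex.exp (ν * s) * deriv θ.1 s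
      = Complex.exp (ν * T) * θ.1 T - Complex.exp (ν * (0 : ℝ)) * θ.1 0
        - ∫ s in (0 : ℝ)..T, ν * Complex.exp (ν * s) * θ.1 s :=
    intervalIntegral.integral_mul_deriv_eq_deriv_mul (fun s _ => hasDerivAt_cexp_mul ν s)
      (fun s _ => testFunctions.hasDerivAt θ.2 s)
      (Continuous.intervalIntegrable (by fun_prop) _ _) (hc'.intervalIntegrable _ _)
  rw [testFunctions.eq_zero_of_notMem_Ioo θ.2 (t := T) (by simp),
    testFunctions.eq_zero_of_notMem_Ioo θ.2 (t := 0) (by simp), mul_zero, mul_zero, sub_zero,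
    zero_sub] at hparts
  simp only [mul_assoc, intervalIntegral.integral_const_mul] at hparts
  rw [expMoment_apply, expMoment_apply, neg_mul]
  exact hparts

theorem expMoment_ne_zero (hT : 0 < T) (ν : ℂ) : expMoment T ν ≠ 0 := by
  let ρ : ContDiffBump (T / 2) := ⟨T / 5, T / 4, by positivity, by linarith⟩
  have hpos : 0 < ∫ s in (0 : ℝ)..T, ρ s :=
    intervalIntegral.integral_pos hT ρ.continuous.continuousOn (fun s _ => ρ.nonneg)
      ⟨T / 2, by constructor <;> linarith,
        ρ.pos_of_mem_ball (Metric.mem_ball_self (show 0 < T / 4 by positivity))⟩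
  have hsupp : tsupport (fun s => ((ρ s : ℝ) : ℂ)) ⊆ Set.Ioo 0 T := by
    have hρ : tsupport (fun s => ((ρ s : ℝ) : ℂ)) ⊆ tsupport ρ :=
      closure_mono fun s hs h₀ => hs (by simp only [h₀, Complex.ofReal_zero])
    rw [ρ.tsupport_eq, Real.closedBall_eq_Icc] at hρ
    exact hρ.trans (Set.Icc_subset_Ioo (show 0 < T / 2 - T / 4 by linarith)
      (show T / 2 + T / 4 < T by linarith))
  let θ : testFunctions T := ⟨fun s => ((ρ s : ℝ) : ℂ) * Complex.exp (-ν * s),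
    (Complex.ofRealCLM.contDiff.comp ρ.contDiff).mul
      (contDiff_const.mul Complex.ofRealCLM.contDiff).cexp,
    (tsupport_mul_subset_left (f := fun s => ((ρ s : ℝ) : ℂ))).trans hsupp⟩
  have hθ : expMoment T ν θ = ((∫ s in (0 : ℝ)..T, ρ s : ℝ) : ℂ) := by
    rw [← intervalIntegral.integral_ofReal]
    refine intervalIntegral.integral_congr fun s _ => ?_
    simp only [θ, mul_left_comm _ ((ρ s : ℝ) : ℂ), ← Complex.exp_add, neg_mul, add_neg_cancel,
      Complex.exp_zero, mul_one]
  intro h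
  rw [h, LinearMap.zero_apply, eq_comm, Complex.ofReal_eq_zero] at hθ
  exact hpos.ne' hθ

/-- The moments are eigenvectors of the transpose of differentiation, with distinct eigenvalues. -/
theorem linearIndependent_expMoment (hT : 0 < T) : LinearIndependent ℂ (expMoment T) :=
  Module.End.eigenvectors_linearIndependent' (testDeriv T).dualMap (fun ν : ℂ => -ν)
    neg_injective _ fun ν => ⟨Module.End.mem_eigenspace_iff.2 <|
      LinearMap.ext fun θ => expMoment_testDeriv ν θ, expMoment_ne_zero hT ν⟩

theorem exists_testFunction_integral_cexp_eq (hT : 0 < T) (E : Finset ℂ) (p : ℂ → ℂ) :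
    ∃ θ ∈ testFunctions T, ∀ ν ∈ E, ∫ s in (0 : ℝ)..T, Complex.exp (ν * s) * θ s = p ν := by
  obtain ⟨θ, hθ⟩ := pi_surjective_of_linearIndependent
    ((linearIndependent_expMoment hT).comp ((↑) : E → ℂ) Subtype.val_injective) fun ν => p ν
  exact ⟨θ, θ.2, fun ν hν => congr_fun hθ ⟨ν, hν⟩⟩

end Moments

section Exponents

open Filter

variable {δ Λ γ : ℝ} {lam : ℕ → ℝ}

theorem complexSqrt_mul_self (d : ℝ) : complexSqrt d * complexSqrt d = d := by
  apply Complex.ext <;> rcases le_total 0 d with h | h <;>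
    simp [complexSqrt, h, Real.sqrt_eq_zero_of_nonpos]

theorem sub_muPlus_mul_sub_muMinus (δ Λ : ℝ) (μ : ℂ) :
    (μ - muPlus δ Λ) * (μ - muMinus δ Λ) = μ * (μ - δ) - Λ * (μ - 1 - δ) := by
  have h := complexSqrt_mul_self ((Λ - δ) ^ 2 - 4 * Λ)
  unfold muPlus muMinus
  push_cast at h ⊢
  linear_combination -h / 4

/-- The characteristic equation of the `Λ`-mode `x' + Λ x + Λ w = 0`, `w' = x - δ w`, where `w` is
the memory integral of `x`: it says that `x + (Λ - μ) w` is a multiple of `e^{-μt}`. -/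
def IsExponent (δ Λ : ℝ) (μ : ℂ) : Prop := μ * (μ - δ) = Λ * (μ - 1 - δ)

theorem isExponent_iff {μ : ℂ} : IsExponent δ Λ μ ↔ μ = muPlus δ Λ ∨ μ = muMinus δ Λ := by
  rw [IsExponent, ← sub_eq_zero, ← sub_muPlus_mul_sub_muMinus, mul_eq_zero, sub_eq_zero,
    sub_eq_zero]

theorem isExponent_muPlus (δ Λ : ℝ) : IsExponent δ Λ (muPlus δ Λ) := isExponent_iff.2 (.inl rfl)

theorem isExponent_muMinus (δ Λ : ℝ) : IsExponent δ Λ (muMinus δ Λ) := isExponent_iff.2 (.inr rfl)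

theorem IsExponent.unique {Λ' : ℝ} {μ : ℂ} (hδ : 0 < δ) (h : IsExponent δ Λ μ)
    (h' : IsExponent δ Λ' μ) : Λ = Λ' := by
  unfold IsExponent at h h'
  have hmul : ((Λ : ℂ) - Λ') * (μ - 1 - δ) = 0 := by linear_combination h' - h
  rcases mul_eq_zero.1 hmul with hΛ | hμ
  · exact_mod_cast sub_eq_zero.1 hΛ
  · rw [hμ, mul_zero] at h
    have hμ' : μ = ((1 + δ : ℝ) : ℂ) := by push_cast; linear_combination hμ
    rw [hμ', ← Complex.ofReal_sub, ← Complex.ofReal_mul, Complex.ofReal_eq_zero] at h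
    nlinarith

theorem muPlus_add_muMinus (δ Λ : ℝ) : muPlus δ Λ + muMinus δ Λ = Λ + δ := by
  unfold muPlus muMinus; push_cast; ring

theorem muPlus_sub_muMinus (δ Λ : ℝ) :
    muPlus δ Λ - muMinus δ Λ = complexSqrt ((Λ - δ) ^ 2 - 4 * Λ) := by
  unfold muPlus muMinus; ring

theorem muPlus_ne_muMinus (hΛ : 0 < Λ) (h : δ ≠ Λ + 2 * √Λ ∧ δ ≠ Λ - 2 * √Λ) :
    muPlus δ Λ ≠ muMinus δ Λ := by
  rw [← sub_ne_zero, muPlus_sub_muMinus]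
  intro h₀
  have hsq := complexSqrt_mul_self ((Λ - δ) ^ 2 - 4 * Λ)
  rw [h₀, mul_zero] at hsq
  have hdiscr : (Λ - δ) ^ 2 - 4 * Λ = 0 := by exact_mod_cast hsq.symm
  have hfactor : (δ - (Λ + 2 * √Λ)) * (δ - (Λ - 2 * √Λ)) = 0 := by
    nlinarith [Real.mul_self_sqrt hΛ.le]
  exact (mul_ne_zero (sub_ne_zero.2 h.1) (sub_ne_zero.2 h.2)) hfactor

theorem muPlus_re (δ Λ : ℝ) : (muPlus δ Λ).re = (Λ + δ + √((Λ - δ) ^ 2 - 4 * Λ)) / 2 := by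
  simp [muPlus, complexSqrt]

theorem muMinus_re (δ Λ : ℝ) : (muMinus δ Λ).re = (Λ + δ - √((Λ - δ) ^ 2 - 4 * Λ)) / 2 := by
  simp [muMinus, complexSqrt]

theorem muMinus_re_le_muPlus_re (δ Λ : ℝ) : (muMinus δ Λ).re ≤ (muPlus δ Λ).re := by
  rw [muPlus_re, muMinus_re]
  linarith [Real.sqrt_nonneg ((Λ - δ) ^ 2 - 4 * Λ)]

theorem muMinus_re_pos (hδ : 0 < δ) (hΛ : 0 < Λ) : 0 < (muMinus δ Λ).re := by
  rw [muMinus_re]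
  have : √((Λ - δ) ^ 2 - 4 * Λ) < Λ + δ := by
    rw [Real.sqrt_lt' (by positivity)]
    nlinarith [mul_pos hδ hΛ]
  linarith

theorem sqrt_discrim_bounds (hδ : 0 < δ) (hΛ : 4 * δ + 8 ≤ Λ) :
    Λ / 2 ≤ √((Λ - δ) ^ 2 - 4 * Λ) ∧ Λ - 3 * δ - 4 ≤ √((Λ - δ) ^ 2 - 4 * Λ) ∧
      √((Λ - δ) ^ 2 - 4 * Λ) ≤ Λ - δ - 2 := by
  refine ⟨Real.le_sqrt_of_sq_le (by nlinarith), Real.le_sqrt_of_sq_le (by nlinarith), ?_⟩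
  rw [Real.sqrt_le_left (by linarith)]
  nlinarith

/-- The coefficient of `e^{-μ⁺ t}` in the free evolution of a mode. -/
def coefPlus (δ Λ : ℝ) : ℂ := (muPlus δ Λ - δ) / (muPlus δ Λ - muMinus δ Λ)

/-- The coefficient of `e^{-μ⁻ t}` in the free evolution of a mode. -/
def coefMinus (δ Λ : ℝ) : ℂ := (δ - muMinus δ Λ) / (muPlus δ Λ - muMinus δ Λ)

theorem coef_bounds_of_large (hδ : 0 < δ) (hΛ : 4 * δ + 8 ≤ Λ) :
    ‖coefPlus δ Λ‖ ≤ 2 ∧ (1 + Λ) * ‖coefMinus δ Λ‖ ≤ 4 * (δ + 2) ∧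
      Λ / (muPlus δ Λ).re ≤ 2 := by
  obtain ⟨hd₁, hd₂, hd₃⟩ := sqrt_discrim_bounds hδ hΛ
  have hd : 0 < √((Λ - δ) ^ 2 - 4 * Λ) := by linarith
  have hreal : complexSqrt ((Λ - δ) ^ 2 - 4 * Λ) = (√((Λ - δ) ^ 2 - 4 * Λ) : ℝ) := by
    rw [complexSqrt, Real.sqrt_eq_zero_of_nonpos (neg_nonpos.2 (Real.sqrt_pos.1 hd).le)]
    simp
  have hre := muPlus_re δ Λ
  set d := √((Λ - δ) ^ 2 - 4 * Λ)
  have hplus : coefPlus δ Λ = (((Λ - δ + d) / 2 / d : ℝ) : ℂ) := by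
    rw [coefPlus, muPlus_sub_muMinus, muPlus, hreal]
    push_cast; ring
  have hminus : coefMinus δ Λ = ((-((Λ - δ - d) / 2 / d) : ℝ) : ℂ) := by
    rw [coefMinus, muPlus_sub_muMinus, muMinus, hreal]
    push_cast; ring
  refine ⟨?_, ?_, ?_⟩
  · rw [hplus, Complex.norm_real, Real.norm_of_nonneg (div_nonneg (by linarith) hd.le),
      div_le_iff₀ hd]
    linarith
  · rw [hminus, Complex.norm_real, norm_neg, Real.norm_of_nonneg (div_nonneg (by linarith) hd.le),
      ← mul_div_assoc, div_le_iff₀ hd]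
    nlinarith
  · rw [hre, div_le_iff₀ (by linarith)]
    linarith

/-- `C` bounds the coefficients of the `Λ`-mode with the weights needed for estimates uniform in
`Λ`; the slow coefficient has to absorb the factor `Λ` of the operator. -/
structure IsCoefBound (C δ Λ : ℝ) : Prop where
  norm_coefPlus_le : ‖coefPlus δ Λ‖ ≤ C
  mul_norm_coefMinus_le : (1 + Λ) * ‖coefMinus δ Λ‖ ≤ C
  div_muPlus_re_le : Λ / (muPlus δ Λ).re ≤ C

theorem IsCoefBound.norm_coefMinus_le {C : ℝ} (h : IsCoefBound C δ Λ) (hΛ : 0 < Λ) :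
    ‖coefMinus δ Λ‖ ≤ C := by
  nlinarith [h.mul_norm_coefMinus_le, norm_nonneg (coefMinus δ Λ)]

theorem exists_isCoefBound (hδ : 0 < δ) (hlam : Tendsto lam atTop atTop) :
    ∃ C, 0 < C ∧ ∀ n, IsCoefBound C δ (lam n) := by
  have hbdd {f : ℕ → ℝ} {c : ℝ} (hf : ∀ n, 4 * δ + 8 ≤ lam n → f n ≤ c) : ∃ C, ∀ n, f n ≤ C := by
    have hev : IsBoundedUnder (· ≤ ·) atTop f :=
      ⟨c, eventually_map.2 ((hlam.eventually_ge_atTop _).mono hf)⟩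
    obtain ⟨C, hC⟩ := hev.bddAbove_range
    exact ⟨C, fun n => hC ⟨n, rfl⟩⟩
  obtain ⟨C₁, h₁⟩ := hbdd fun n hn => (coef_bounds_of_large hδ hn).1
  obtain ⟨C₂, h₂⟩ := hbdd fun n hn => (coef_bounds_of_large hδ hn).2.1
  obtain ⟨C₃, h₃⟩ := hbdd fun n hn => (coef_bounds_of_large hδ hn).2.2
  refine ⟨max 1 (max C₁ (max C₂ C₃)), by positivity, fun n =>
    ⟨(h₁ n).trans ?_, (h₂ n).trans ?_, (h₃ n).trans ?_⟩⟩ <;> simp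

theorem lt_muMinus_re_of_unstableDim_le (hδ : 0 < δ) (hγ : γ < δ + 1)
    (hlam : Tendsto lam atTop atTop) {n : ℕ} (hn : unstableDim δ γ lam ≤ n) :
    γ < (muMinus δ (lam n)).re := by
  by_contra! h
  have hbdd : BddAbove {n : ℕ | ∃ j : ℕ, n = j + 1 ∧ (muMinus δ (lam j)).re ≤ γ} := by
    obtain ⟨m, hm⟩ := eventually_atTop.1 (hlam.eventually_ge_atTop (4 * δ + 8))
    refine ⟨m, ?_⟩
    rintro _ ⟨j, rfl, hj⟩
    by_contra! hlt
    have hlarge := (sqrt_discrim_bounds hδ (hm j (by omega))).2.2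
    rw [muMinus_re] at hj
    linarith
  have hsucc : n + 1 ≤ _ := le_csSup hbdd ⟨n, rfl, h⟩
  have hle := (le_max_right _ _).trans hn
  omega

theorem sSup_mem_of_pos {S : Set ℕ} (h : 0 < sSup S) : sSup S ∈ S := by
  refine Nat.sSup_mem (Set.nonempty_iff_ne_empty.2 ?_) ?_
  · rintro rfl
    simp at h
  · by_contra hb
    exact h.ne' (Nat.sSup_of_not_bddAbove hb)

theorem muMinus_re_le_of_unstableDim_pos (h : 0 < unstableDim δ γ lam) :
    (muMinus δ (lam (unstableDim δ γ lam - 1))).re ≤ γ := by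
  rcases max_choice (sSup {n : ℕ | ∃ j : ℕ, n = j + 1 ∧ (muPlus δ (lam j)).re ≤ γ})
    (sSup {n : ℕ | ∃ j : ℕ, n = j + 1 ∧ (muMinus δ (lam j)).re ≤ γ}) with hmax | hmax
  all_goals
    change unstableDim δ γ lam = _ at hmax
    obtain ⟨j, hj, hre⟩ := sSup_mem_of_pos (hmax ▸ h)
    rw [hmax, hj, Nat.add_sub_cancel]
  · exact (muMinus_re_le_muPlus_re _ _).trans hre
  · exact hre

theorem lt_unstableDim_of_eq (hδ : 0 < δ) (hγ : γ < δ + 1) (hlam : Tendsto lam atTop atTop)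
    (hmono : Monotone lam) {j n : ℕ} (hj : j < unstableDim δ γ lam) (h : lam n = lam j) :
    n < unstableDim δ γ lam := by
  by_contra! hn
  have hlast : lam n = lam (unstableDim δ γ lam - 1) :=
    le_antisymm (h ▸ hmono (by omega)) (hmono (by omega))
  have hlt := lt_muMinus_re_of_unstableDim_le hδ hγ hlam hn
  rw [hlast] at hlt
  exact hlt.not_ge (muMinus_re_le_of_unstableDim_pos (by omega))

end Exponents

section Duhamel

open Set MeasureTheory

theorem intervalIntegrable_of_continuousOn_Ici {E : Type*} [NormedAddCommGroup E] {f : ℝ → E}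
    (hf : ContinuousOn f (Ici 0)) {t : ℝ} (ht : 0 ≤ t) : IntervalIntegrable f volume 0 t :=
  (hf.mono (by rw [uIcc_of_le ht]; exact Icc_subset_Ici_self)).intervalIntegrable

theorem hasDerivWithinAt_integral_Ici {E : Type*} [NormedAddCommGroup E] [NormedSpace ℝ E]
    [CompleteSpace E] {f : ℝ → E} (hf : ContinuousOn f (Ici 0)) {t : ℝ} (ht : 0 ≤ t) :
    HasDerivWithinAt (fun r => ∫ s in (0 : ℝ)..r, f s) (f t) (Ici 0) t := by
  have hc : Continuous fun s => f (max s 0) :=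
    hf.comp_continuous (by fun_prop) fun s => le_max_right s 0
  have hd := (hc.integral_hasStrictDerivAt 0 t).hasDerivAt.hasDerivWithinAt (s := Ici 0)
  rw [max_eq_left ht] at hd
  refine hd.congr_of_mem (fun r hr => intervalIntegral.integral_congr fun s hs => ?_) ht
  rw [uIcc_of_le hr] at hs
  exact congrArg f (max_eq_left hs.1).symm

theorem integral_eq_sub_of_hasDerivWithinAt_Ici {E : Type*} [NormedAddCommGroup E]
    [NormedSpace ℝ E] [CompleteSpace E] {x f : ℝ → E} (hf : ContinuousOn f (Ici 0))
    (hx : ∀ t, 0 ≤ t → HasDerivWithinAt x (f t) (Ici 0) t) {t : ℝ} (ht : 0 ≤ t) :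
    ∫ s in (0 : ℝ)..t, f s = x t - x 0 :=
  intervalIntegral.integral_eq_sub_of_hasDerivAt_of_le ht
    (fun s hs => (hx s hs.1).continuousWithinAt.mono Icc_subset_Ici_self)
    (fun s hs => (hx s hs.1.le).hasDerivAt (Ici_mem_nhds hs.1))
    (intervalIntegrable_of_continuousOn_Ici hf ht)

theorem eq_exp_of_hasDerivAt {δ : ℝ} {β : ℝ → ℝ} (hβ : ∀ t, HasDerivAt β (-δ * β t) t)
    (hβ0 : β 0 = 1) (t : ℝ) : β t = Real.exp (-δ * t) := by
  have hd (s : ℝ) : HasDerivAt (fun s => Real.exp (δ * s) * β s) 0 s :=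
    (((hasDerivAt_id s).const_mul δ).exp.mul (hβ s)).congr_deriv (by simp only [id_eq]; ring)
  have hconst := is_const_of_deriv_eq_zero (fun s => (hd s).differentiableAt)
    (fun s => (hd s).deriv) t 0
  simp only [hβ0, mul_zero, Real.exp_zero, one_mul] at hconst
  rw [neg_mul, Real.exp_neg, eq_comm, inv_eq_of_mul_eq_one_right hconst]

theorem norm_cexp_mul_ofReal (μ : ℂ) (t : ℝ) : ‖Complex.exp (μ * t)‖ = Real.exp (μ.re * t) := by
  simp [Complex.norm_exp]

theorem cexp_neg_mul_cexp (μ : ℂ) (t : ℝ) : Complex.exp (-μ * t) * Complex.exp (μ * t) = 1 := by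
  rw [← Complex.exp_add]
  simp

variable {E : Type*} [NormedAddCommGroup E] [NormedSpace ℂ E] {μ : ℂ} {a : E} {f : ℝ → E} {t : ℝ}

/-- Duhamel's formula for the solution of `x' = f - μ x`, `x 0 = a`. -/
def duhamel (μ : ℂ) (a : E) (f : ℝ → E) (t : ℝ) : E :=
  Complex.exp (-μ * t) • (a + ∫ s in (0 : ℝ)..t, Complex.exp (μ * s) • f s)

theorem duhamel_zero (μ : ℂ) (a : E) (f : ℝ → E) : duhamel μ a f 0 = a := by simp [duhamel]

theorem integral_smul_eq_duhamel {δ : ℝ} {β : ℝ → ℝ} (hβ : ∀ t, β t = Real.exp (-δ * t))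
    (f : ℝ → E) (t : ℝ) : ∫ s in (0 : ℝ)..t, (β (t - s) : ℂ) • f s = duhamel δ 0 f t := by
  rw [duhamel, zero_add, ← intervalIntegral.integral_smul]
  congr 1 with s
  rw [hβ, smul_smul, ← Complex.exp_add, Complex.ofReal_exp]
  congr 2
  push_cast
  ring

theorem continuousOn_cexp_mul_smul (μ : ℂ) (hf : ContinuousOn f (Ici 0)) :
    ContinuousOn (fun s : ℝ => Complex.exp (μ * s) • f s) (Ici 0) :=
  ContinuousOn.smul (by fun_prop) hf

theorem norm_duhamel_le_integral {ρ : ℝ} (hρ : ρ ≤ μ.re) (hf : ContinuousOn f (Ici 0))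
    (ht : 0 ≤ t) :
    ‖duhamel μ a f t‖ ≤
      Real.exp (-ρ * t) * (‖a‖ + ∫ s in (0 : ℝ)..t, Real.exp (ρ * s) * ‖f s‖) := by
  have hexp {s : ℝ} (hs : s ≤ t) :
      Real.exp (-μ.re * t) * Real.exp (μ.re * s) ≤ Real.exp (-ρ * t) * Real.exp (ρ * s) := by
    rw [← Real.exp_add, ← Real.exp_add, Real.exp_le_exp]
    nlinarith
  have hint : ContinuousOn (fun s => Real.exp (ρ * s) * ‖f s‖) (Ici 0) :=
    ContinuousOn.mul (by fun_prop) hf.norm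
  have hfree : ‖Complex.exp (-μ * t) • a‖ ≤ Real.exp (-ρ * t) * ‖a‖ := by
    rw [norm_smul, norm_cexp_mul_ofReal, Complex.neg_re]
    have := hexp ht
    simp only [mul_zero, Real.exp_zero, mul_one] at this
    gcongr
  have hforced : ‖∫ s in (0 : ℝ)..t, Complex.exp (-μ * t) • Complex.exp (μ * s) • f s‖ ≤
      ∫ s in (0 : ℝ)..t, Real.exp (-ρ * t) * (Real.exp (ρ * s) * ‖f s‖) := by
    refine intervalIntegral.norm_integral_le_of_norm_le ht (.of_forall fun s hs => ?_)
      ((intervalIntegrable_of_continuousOn_Ici hint ht).const_mul _)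
    rw [norm_smul, norm_smul, norm_cexp_mul_ofReal, norm_cexp_mul_ofReal, Complex.neg_re,
      ← mul_assoc, ← mul_assoc]
    exact mul_le_mul_of_nonneg_right (hexp hs.2) (norm_nonneg _)
  rw [intervalIntegral.integral_const_mul] at hforced
  rw [duhamel, smul_add, ← intervalIntegral.integral_smul, mul_add]
  exact (norm_add_le _ _).trans (add_le_add hfree hforced)

theorem norm_duhamel_le {F : ℝ} (hμ : 0 < μ.re) (hf : ContinuousOn f (Ici 0))
    (hF : ∀ s, ‖f s‖ ≤ F) (ht : 0 ≤ t) : ‖duhamel μ a f t‖ ≤ ‖a‖ + F / μ.re := by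
  set ρ := μ.re
  have hint : ∫ s in (0 : ℝ)..t, Real.exp (ρ * s) * ‖f s‖ ≤ Real.exp (ρ * t) * (F / ρ) := by
    calc ∫ s in (0 : ℝ)..t, Real.exp (ρ * s) * ‖f s‖ ≤ ∫ s in (0 : ℝ)..t, Real.exp (ρ * s) * F := by
          refine intervalIntegral.integral_mono_on ht
            (intervalIntegrable_of_continuousOn_Ici (ContinuousOn.mul (by fun_prop) hf.norm) ht)
            (Continuous.intervalIntegrable (by fun_prop) _ _) fun s _ => ?_
          gcongr
          exact hF s
      _ = (Real.exp (ρ * t) - 1) * (F / ρ) := by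
          rw [intervalIntegral.integral_mul_const,
            intervalIntegral.integral_comp_mul_left _ hμ.ne', integral_exp]
          simp only [mul_zero, Real.exp_zero, smul_eq_mul]
          ring
      _ ≤ Real.exp (ρ * t) * (F / ρ) := by
          have hF0 : 0 ≤ F := (norm_nonneg _).trans (hF 0)
          gcongr
          linarith
  have hone : Real.exp (-ρ * t) * Real.exp (ρ * t) = 1 := by rw [← Real.exp_add]; simp
  calc ‖duhamel μ a f t‖ ≤ Real.exp (-ρ * t) * (‖a‖ + Real.exp (ρ * t) * (F / ρ)) :=
        (norm_duhamel_le_integral le_rfl hf ht).trans (by gcongr)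
    _ = Real.exp (-ρ * t) * ‖a‖ + F / ρ := by linear_combination (F / ρ) * hone
    _ ≤ ‖a‖ + F / ρ := by
        gcongr
        exact mul_le_of_le_one_left (norm_nonneg _) (Real.exp_le_one_iff.2 (by nlinarith))

theorem integral_eq_of_eq_zero_of_le {E : Type*} [NormedAddCommGroup E] [NormedSpace ℝ E]
    {g : ℝ → E} {T : ℝ} (hg : ContinuousOn g (Ici 0)) (hg0 : ∀ s, T ≤ s → g s = 0) (hT : 0 ≤ T)
    (hTt : T ≤ t) : ∫ s in (0 : ℝ)..t, g s = ∫ s in (0 : ℝ)..T, g s := by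
  have htail : ∫ s in T..t, g s = 0 := by
    rw [intervalIntegral.integral_congr (g := fun _ => (0 : E)), intervalIntegral.integral_zero]
    intro s hs
    rw [uIcc_of_le hTt] at hs
    exact hg0 s hs.1
  have hT' := intervalIntegrable_of_continuousOn_Ici hg hT
  rw [← intervalIntegral.integral_interval_sub_left
    (intervalIntegrable_of_continuousOn_Ici hg (hT.trans hTt)) hT', sub_eq_zero] at htail
  exact htail

theorem duhamel_of_le {T : ℝ} (hf : ContinuousOn f (Ici 0)) (hf0 : ∀ s, T ≤ s → f s = 0)
    (hT : 0 ≤ T) (hTt : T ≤ t) :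
    duhamel μ a f t =
      Complex.exp (-μ * t) • (a + ∫ s in (0 : ℝ)..T, Complex.exp (μ * s) • f s) := by
  rw [duhamel, integral_eq_of_eq_zero_of_le (continuousOn_cexp_mul_smul μ hf)
    (fun s hs => by rw [hf0 s hs, smul_zero]) hT hTt]

theorem norm_duhamel_le_exp {F T ρ : ℝ} (hρ : 0 ≤ ρ) (hρμ : ρ ≤ μ.re)
    (hf : ContinuousOn f (Ici 0)) (hF : ∀ s, ‖f s‖ ≤ F) (hf0 : ∀ s, T ≤ s → f s = 0)
    (hT : 0 ≤ T) (ht : 0 ≤ t) :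
    ‖duhamel μ a f t‖ ≤ Real.exp (-ρ * t) * (Real.exp (ρ * T) * (‖a‖ + T * F)) := by
  have hg : ContinuousOn (fun s => Real.exp (ρ * s) * ‖f s‖) (Ici 0) :=
    ContinuousOn.mul (by fun_prop) hf.norm
  have hint {r : ℝ} (hr : 0 ≤ r) (hrT : r ≤ T) :
      ∫ s in (0 : ℝ)..r, Real.exp (ρ * s) * ‖f s‖ ≤ Real.exp (ρ * T) * (T * F) := by
    have hF0 : 0 ≤ F := (norm_nonneg _).trans (hF 0)
    calc ∫ s in (0 : ℝ)..r, Real.exp (ρ * s) * ‖f s‖ ≤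
          ∫ _ in (0 : ℝ)..r, Real.exp (ρ * T) * F := by
          refine intervalIntegral.integral_mono_on hr
            (intervalIntegrable_of_continuousOn_Ici hg hr) (by simp) fun s hs => ?_
          gcongr
          · exact hs.2.trans hrT
          · exact hF s
      _ = Real.exp (ρ * T) * (r * F) := by
          rw [intervalIntegral.integral_const, sub_zero, smul_eq_mul]
          ring
      _ ≤ Real.exp (ρ * T) * (T * F) := by gcongr
  refine (norm_duhamel_le_integral hρμ hf ht).trans ?_
  rw [mul_add (Real.exp (ρ * T))]
  gcongr
  · exact le_mul_of_one_le_left (norm_nonneg _) (Real.one_le_exp (by positivity))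
  · rcases le_total t T with h | h
    · exact hint ht h
    · rw [integral_eq_of_eq_zero_of_le hg (fun s hs => by simp [hf0 s hs]) hT h]
      exact hint hT le_rfl

theorem duhamel_congr {g : ℝ → E} (h : EqOn f g (Ici 0)) (ht : 0 ≤ t) :
    duhamel μ a f t = duhamel μ a g t := by
  unfold duhamel
  congr 2
  refine intervalIntegral.integral_congr fun s hs => ?_
  rw [uIcc_of_le ht] at hs
  exact congrArg (Complex.exp (μ * s) • ·) (h hs.1)

variable [CompleteSpace E]

theorem hasDerivWithinAt_duhamel (μ : ℂ) (a : E) (hf : ContinuousOn f (Ici 0)) (ht : 0 ≤ t) :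
    HasDerivWithinAt (duhamel μ a f) (f t - μ • duhamel μ a f t) (Ici 0) t := by
  have hd := (hasDerivAt_cexp_mul (-μ) t).hasDerivWithinAt.smul
    ((hasDerivWithinAt_integral_Ici (continuousOn_cexp_mul_smul μ hf) ht).const_add a)
  refine hd.congr_deriv ?_
  rw [smul_smul, cexp_neg_mul_cexp, duhamel]
  module

theorem continuousOn_duhamel (μ : ℂ) (a : E) (hf : ContinuousOn f (Ici 0)) :
    ContinuousOn (duhamel μ a f) (Ici 0) :=
  fun _ ht => (hasDerivWithinAt_duhamel μ a hf ht).continuousWithinAt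

theorem eqOn_duhamel {x : ℝ → E} (hf : ContinuousOn f (Ici 0)) (hx₀ : x 0 = a)
    (hx : ∀ t, 0 ≤ t → HasDerivWithinAt x (f t - μ • x t) (Ici 0) t) :
    EqOn x (duhamel μ a f) (Ici 0) := by
  intro t ht
  have hd (s : ℝ) (hs : 0 ≤ s) : HasDerivWithinAt (fun s : ℝ => Complex.exp (μ * s) • x s)
      (Complex.exp (μ * s) • f s) (Ici 0) s :=
    ((hasDerivAt_cexp_mul μ s).hasDerivWithinAt.smul (hx s hs)).congr_deriv (by module)
  rw [duhamel, integral_eq_sub_of_hasDerivWithinAt_Ici (continuousOn_cexp_mul_smul μ hf) hd ht,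
    Complex.ofReal_zero, mul_zero, Complex.exp_zero, one_smul, hx₀, add_sub_cancel, smul_smul,
    cexp_neg_mul_cexp, one_smul]

theorem inner_duhamel {E : Type*} [NormedAddCommGroup E] [InnerProductSpace ℂ E] [CompleteSpace E]
    {f : ℝ → E} (hf : ContinuousOn f (Ici 0)) (μ : ℂ) (x a : E) (ht : 0 ≤ t) :
    ⟪x, duhamel μ a f t⟫_ℂ = duhamel μ ⟪x, a⟫_ℂ (fun s => ⟪x, f s⟫_ℂ) t := by
  refine eqOn_duhamel (x := fun r => ⟪x, duhamel μ a f r⟫_ℂ)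
    ((innerSL ℂ x).continuous.comp_continuousOn hf) (by rw [duhamel_zero]) (fun s hs => ?_) ht
  have hd := ((innerSL ℂ x).restrictScalars ℝ).hasFDerivAt.comp_hasDerivWithinAt s
    (hasDerivWithinAt_duhamel μ a hf hs)
  exact hd.congr_deriv (by simp [inner_sub_right, inner_smul_right])

end Duhamel

section Modes

open Set

variable {δ Λ : ℝ} {a : ℂ} {f : ℝ → ℂ} {t : ℝ}

/-- The solution of `x' + Λ x + Λ ∫₀ᵗ e^{-δ(t-s)} x(s) ds = f`, `x 0 = a`: the coordinate of a
solution along an eigenvector with eigenvalue `Λ`. -/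
def mode (δ Λ : ℝ) (a : ℂ) (f : ℝ → ℂ) (t : ℝ) : ℂ :=
  coefPlus δ Λ * duhamel (muPlus δ Λ) a f t + coefMinus δ Λ * duhamel (muMinus δ Λ) a f t

theorem norm_mode_le_add :
    ‖mode δ Λ a f t‖ ≤ ‖coefPlus δ Λ‖ * ‖duhamel (muPlus δ Λ) a f t‖ +
      ‖coefMinus δ Λ‖ * ‖duhamel (muMinus δ Λ) a f t‖ := by
  rw [← norm_mul, ← norm_mul]
  exact norm_add_le _ _

theorem coefPlus_add_coefMinus (h : muPlus δ Λ ≠ muMinus δ Λ) :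
    coefPlus δ Λ + coefMinus δ Λ = 1 := by
  rw [coefPlus, coefMinus, ← add_div, div_eq_one_iff_eq (sub_ne_zero.2 h)]
  ring

theorem mode_zero (h : muPlus δ Λ ≠ muMinus δ Λ) : mode δ Λ a f 0 = a := by
  rw [mode, duhamel_zero, duhamel_zero, ← add_mul, coefPlus_add_coefMinus h, one_mul]

theorem continuousOn_mode (hf : ContinuousOn f (Ici 0)) :
    ContinuousOn (mode δ Λ a f) (Ici 0) :=
  ((continuousOn_duhamel _ a hf).const_mul _).add ((continuousOn_duhamel _ a hf).const_mul _)

theorem duhamel_mode (h : muPlus δ Λ ≠ muMinus δ Λ) (hf : ContinuousOn f (Ici 0)) (ht : 0 ≤ t) :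
    duhamel δ 0 (mode δ Λ a f) t = (duhamel (muMinus δ Λ) a f t - duhamel (muPlus δ Λ) a f t) /
      (muPlus δ Λ - muMinus δ Λ) := by
  have hne := sub_ne_zero.2 h
  refine (eqOn_duhamel (x := fun t => (duhamel (muMinus δ Λ) a f t - duhamel (muPlus δ Λ) a f t) /
    (muPlus δ Λ - muMinus δ Λ)) (continuousOn_mode hf) (by simp [duhamel_zero])
    (fun s hs => ?_) ht).symm
  refine (((hasDerivWithinAt_duhamel _ a hf hs).sub
    (hasDerivWithinAt_duhamel _ a hf hs)).div_const _).congr_deriv ?_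
  simp only [mode, coefPlus, coefMinus, smul_eq_mul]
  field_simp
  ring

theorem hasDerivWithinAt_mode (h : muPlus δ Λ ≠ muMinus δ Λ) (hf : ContinuousOn f (Ici 0))
    (ht : 0 ≤ t) :
    HasDerivWithinAt (mode δ Λ a f)
      (f t - Λ * (mode δ Λ a f t + duhamel δ 0 (mode δ Λ a f) t)) (Ici 0) t := by
  have hne := sub_ne_zero.2 h
  have hplus := isExponent_muPlus δ Λ
  have hminus := isExponent_muMinus δ Λ
  unfold IsExponent at hplus hminus
  refine (((hasDerivWithinAt_duhamel _ a hf ht).const_mul (coefPlus δ Λ)).add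
    ((hasDerivWithinAt_duhamel _ a hf ht).const_mul (coefMinus δ Λ))).congr_deriv ?_
  rw [duhamel_mode h hf ht]
  simp only [mode, coefPlus, coefMinus, smul_eq_mul]
  field_simp
  linear_combination -(duhamel (muPlus δ Λ) a f t) * hplus + (duhamel (muMinus δ Λ) a f t) * hminus

theorem IsExponent.eqOn_duhamel {μ : ℂ} (hμ : IsExponent δ Λ μ) {x : ℝ → ℂ}
    (hf : ContinuousOn f (Ici 0)) (hx₀ : x 0 = a)
    (hx : ∀ t, 0 ≤ t →
      HasDerivWithinAt x (f t - Λ * (x t + duhamel δ 0 x t)) (Ici 0) t) :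
    EqOn (fun t => x t + (Λ - μ) * duhamel δ 0 x t) (duhamel μ a f) (Ici 0) := by
  have hxc : ContinuousOn x (Ici 0) := fun t ht => (hx t ht).continuousWithinAt
  unfold IsExponent at hμ
  refine PIDE.eqOn_duhamel hf (by simp [duhamel_zero, hx₀]) fun t ht =>
    ((hx t ht).add ((hasDerivWithinAt_duhamel (δ : ℂ) 0 hxc ht).const_mul (Λ - μ))).congr_deriv ?_
  simp only [smul_eq_mul]
  linear_combination -(duhamel δ 0 x t) * hμ

theorem eqOn_mode (h : muPlus δ Λ ≠ muMinus δ Λ) {x : ℝ → ℂ} (hf : ContinuousOn f (Ici 0))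
    (hx₀ : x 0 = a)
    (hx : ∀ t, 0 ≤ t →
      HasDerivWithinAt x (f t - Λ * (x t + duhamel δ 0 x t)) (Ici 0) t) :
    EqOn x (mode δ Λ a f) (Ici 0) := by
  intro t ht
  have hne := sub_ne_zero.2 h
  have hsum := muPlus_add_muMinus δ Λ
  rw [mode, ← (isExponent_muPlus δ Λ).eqOn_duhamel hf hx₀ hx ht,
    ← (isExponent_muMinus δ Λ).eqOn_duhamel hf hx₀ hx ht, coefPlus, coefMinus]
  field_simp
  linear_combination (duhamel δ 0 x t * (muPlus δ Λ - muMinus δ Λ)) * hsum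

theorem norm_duhamel_le_of_moment {μ : ℂ} {F T γ : ℝ} (hT : 0 ≤ T) (hγ : 0 < γ) (hμ : 0 < μ.re)
    (hf : ContinuousOn f (Ici 0)) (hF : ∀ s, ‖f s‖ ≤ F) (hf0 : ∀ s, T ≤ s → f s = 0)
    (hmom : γ ≤ μ.re ∨ a + ∫ s in (0 : ℝ)..T, Complex.exp (μ * s) * f s = 0) (ht : 0 ≤ t) :
    ‖duhamel μ a f t‖ ≤ Real.exp (-γ * t) * (Real.exp (γ * T) * (‖a‖ + T * F)) := by
  have hF0 : 0 ≤ F := (norm_nonneg _).trans (hF 0)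
  rcases hmom with h | h
  · exact norm_duhamel_le_exp hγ.le h hf hF hf0 hT ht
  rcases le_total T t with hTt | htT
  · simp only [duhamel_of_le hf hf0 hT hTt, smul_eq_mul, h, mul_zero, norm_zero]
    positivity
  · have hle := norm_duhamel_le_exp (a := a) le_rfl hμ.le hf hF hf0 hT ht
    simp only [neg_zero, zero_mul, Real.exp_zero, one_mul] at hle
    rw [← mul_assoc, ← Real.exp_add]
    exact hle.trans (le_mul_of_one_le_left (by positivity) (Real.one_le_exp (by nlinarith)))

theorem norm_mode_le {C F T γ : ℝ} (hC : IsCoefBound C δ Λ) (hδ : 0 < δ) (hΛ : 0 < Λ)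
    (hT : 0 ≤ T) (hγ : 0 < γ) (hf : ContinuousOn f (Ici 0)) (hF : ∀ s, ‖f s‖ ≤ F)
    (hf0 : ∀ s, T ≤ s → f s = 0)
    (hmom : γ ≤ (muMinus δ Λ).re ∨
      ∀ μ, IsExponent δ Λ μ → a + ∫ s in (0 : ℝ)..T, Complex.exp (μ * s) * f s = 0)
    (ht : 0 ≤ t) :
    ‖mode δ Λ a f t‖ ≤ Real.exp (-γ * t) * (2 * C * Real.exp (γ * T)) * (‖a‖ + T * F) := by
  have hre := muMinus_re_le_muPlus_re δ Λ
  have hpos := muMinus_re_pos hδ hΛ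
  have hplus := norm_duhamel_le_of_moment hT hγ (hpos.trans_le hre) hf hF hf0
    (hmom.imp hre.trans' fun h => h _ (isExponent_muPlus δ Λ)) ht
  have hminus := norm_duhamel_le_of_moment hT hγ hpos hf hF hf0
    (hmom.imp_right fun h => h _ (isExponent_muMinus δ Λ)) ht
  calc ‖mode δ Λ a f t‖ ≤ ‖coefPlus δ Λ‖ * ‖duhamel (muPlus δ Λ) a f t‖ +
        ‖coefMinus δ Λ‖ * ‖duhamel (muMinus δ Λ) a f t‖ := norm_mode_le_add
    _ ≤ C * (Real.exp (-γ * t) * (Real.exp (γ * T) * (‖a‖ + T * F))) +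
        C * (Real.exp (-γ * t) * (Real.exp (γ * T) * (‖a‖ + T * F))) := by
        have hC0 : 0 ≤ C := (norm_nonneg _).trans hC.norm_coefPlus_le
        gcongr
        · exact hC.norm_coefPlus_le
        · exact hC.norm_coefMinus_le hΛ
    _ = _ := by ring

theorem mul_norm_mode_le {C F T : ℝ} (hC : IsCoefBound C δ Λ) (hδ : 0 < δ) (hΛ : 0 < Λ)
    (hT : 0 ≤ T) (hf : ContinuousOn f (Ici 0)) (hF : ∀ s, ‖f s‖ ≤ F)
    (hf0 : ∀ s, T ≤ s → f s = 0) (ht : 0 ≤ t) :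
    Λ * ‖mode δ Λ a f t‖ ≤ C * (Λ * ‖a‖ + C * F) + C * (‖a‖ + T * F) := by
  have hpos := muMinus_re_pos hδ hΛ
  have hF0 : 0 ≤ F := (norm_nonneg _).trans (hF 0)
  have hC0 : 0 ≤ C := (norm_nonneg _).trans hC.norm_coefPlus_le
  have hplus : Λ * ‖duhamel (muPlus δ Λ) a f t‖ ≤ Λ * ‖a‖ + C * F := calc
    _ ≤ Λ * (‖a‖ + F / (muPlus δ Λ).re) := by
        gcongr
        exact norm_duhamel_le (hpos.trans_le (muMinus_re_le_muPlus_re _ _)) hf hF ht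
    _ = Λ * ‖a‖ + Λ / (muPlus δ Λ).re * F := by ring
    _ ≤ Λ * ‖a‖ + C * F := by
        gcongr
        exact hC.div_muPlus_re_le
  have hminus : ‖duhamel (muMinus δ Λ) a f t‖ ≤ ‖a‖ + T * F := by
    simpa using norm_duhamel_le_exp (a := a) le_rfl hpos.le hf hF hf0 hT ht
  calc Λ * ‖mode δ Λ a f t‖ ≤ Λ * (‖coefPlus δ Λ‖ * ‖duhamel (muPlus δ Λ) a f t‖ +
        ‖coefMinus δ Λ‖ * ‖duhamel (muMinus δ Λ) a f t‖) := by
        gcongr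
        exact norm_mode_le_add
    _ = ‖coefPlus δ Λ‖ * (Λ * ‖duhamel (muPlus δ Λ) a f t‖) +
        Λ * ‖coefMinus δ Λ‖ * ‖duhamel (muMinus δ Λ) a f t‖ := by ring
    _ ≤ C * (Λ * ‖a‖ + C * F) + C * (‖a‖ + T * F) := by
        gcongr
        · exact hC.norm_coefPlus_le
        · nlinarith [hC.mul_norm_coefMinus_le, norm_nonneg (coefMinus δ Λ)]

end Modes

section ModalCalculus

open Set

variable {E ι : Type*} [NormedAddCommGroup E] [InnerProductSpace ℂ E]
  {b : HilbertBasis ι ℂ E} {y p q : ℝ → E} {t : ℝ}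

/-- The trajectory with initial value `y₀` and right-hand side `f`, described by its coordinates in
the eigenbasis `b`. -/
structure IsModalSolution (b : HilbertBasis ι ℂ E) (lam : ι → ℝ) (δ : ℝ) (f : ℝ → E) (y₀ : E)
    (y : ℝ → E) : Prop where
  cont : ContinuousOn y (Ici 0)
  inner_eq : ∀ t, 0 ≤ t → ∀ i, ⟪b i, y t⟫_ℂ = mode δ (lam i) ⟪b i, y₀⟫_ℂ (fun s => ⟪b i, f s⟫_ℂ) t

namespace IsModalSolution

variable {lam : ι → ℝ} {δ : ℝ} {f : ℝ → E} {y₀ : E}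

theorem eqOn {y' : ℝ → E} (hy' : IsModalSolution b lam δ f y₀ y')
    (hy : IsModalSolution b lam δ f y₀ y) : EqOn y' y (Ici 0) :=
  fun t ht => eq_of_forall_inner_eq b fun i => by rw [hy'.inner_eq t ht, hy.inner_eq t ht]

theorem init (hne : ∀ i, muPlus δ (lam i) ≠ muMinus δ (lam i))
    (hy : IsModalSolution b lam δ f y₀ y) : y 0 = y₀ :=
  eq_of_forall_inner_eq b fun i => by rw [hy.inner_eq 0 le_rfl, mode_zero (hne i)]

end IsModalSolution

variable [CompleteSpace E]

theorem inner_integral_Ici (x : E) (hp : ContinuousOn p (Ici 0)) (ht : 0 ≤ t) :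
    ⟪x, ∫ s in (0 : ℝ)..t, p s⟫_ℂ = ∫ s in (0 : ℝ)..t, ⟪x, p s⟫_ℂ :=
  ((innerSL ℂ x).intervalIntegral_comp_comm (intervalIntegrable_of_continuousOn_Ici hp ht)).symm

theorem hasDerivWithinAt_inner_integral (x : E) (hp : ContinuousOn p (Ici 0)) (ht : 0 ≤ t) :
    HasDerivWithinAt (fun r => ⟪x, ∫ s in (0 : ℝ)..r, p s⟫_ℂ) ⟪x, p t⟫_ℂ (Ici 0) t :=
  (hasDerivWithinAt_integral_Ici (f := fun s => ⟪x, p s⟫_ℂ) (continuousOn_const.inner hp) ht).congr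
    (fun _ hr => inner_integral_Ici x hp hr) (inner_integral_Ici x hp ht)

theorem hasDerivWithinAt_of_inner (hp : ContinuousOn p (Ici 0))
    (hy : ∀ i t, 0 ≤ t → HasDerivWithinAt (fun s => ⟪b i, y s⟫_ℂ) ⟪b i, p t⟫_ℂ (Ici 0) t)
    (ht : 0 ≤ t) : HasDerivWithinAt y (p t) (Ici 0) t := by
  have heq (s : ℝ) (hs : 0 ≤ s) : y s = y 0 + ∫ r in (0 : ℝ)..s, p r := by
    refine eq_of_forall_inner_eq b fun i => ?_
    rw [inner_add_right, inner_integral_Ici _ hp hs, integral_eq_sub_of_hasDerivWithinAt_Ici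
      (continuousOn_const.inner hp) (hy i) hs, add_sub_cancel]
  exact ((hasDerivWithinAt_integral_Ici hp ht).const_add (y 0)).congr heq (heq t ht)

/-- In the limit of partial sums one cannot differentiate termwise, as `T y` need not exist; but
`y t - y 0 - ∫ p = -T (∫ q)` holds, and its inner product with `x` can be differentiated. -/
theorem IsDiagonalIn.hasDerivWithinAt_inner {T : E →ₗ.[ℂ] E} {lam : ι → ℝ}
    (hT : IsDiagonalIn T b lam) (hp : ContinuousOn p (Ici 0)) (hq : ContinuousOn q (Ici 0))
    (hy : ∀ i t, 0 ≤ t → HasDerivWithinAt (fun s => ⟪b i, y s⟫_ℂ)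
      (⟪b i, p t⟫_ℂ - lam i * ⟪b i, q t⟫_ℂ) (Ici 0) t)
    {x z : E} (hxz : (x, z) ∈ T.graph) (ht : 0 ≤ t) :
    HasDerivWithinAt (fun s => ⟪x, y s⟫_ℂ) (⟪x, p t⟫_ℂ - ⟪z, q t⟫_ℂ) (Ici 0) t := by
  have hcoord (s : ℝ) (hs : 0 ≤ s) (i : ι) :
      ⟪b i, y 0 + (∫ r in (0 : ℝ)..s, p r) - y s⟫_ℂ =
        lam i * ⟪b i, ∫ r in (0 : ℝ)..s, q r⟫_ℂ := by
    have hint := integral_eq_sub_of_hasDerivWithinAt_Ici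
      ((continuousOn_const.inner hp).sub ((continuousOn_const.inner hq).const_mul _)) (hy i) hs
    rw [intervalIntegral.integral_sub
      (intervalIntegrable_of_continuousOn_Ici (continuousOn_const.inner hp) hs)
      (intervalIntegrable_of_continuousOn_Ici ((continuousOn_const.inner hq).const_mul _) hs),
      intervalIntegral.integral_const_mul, ← inner_integral_Ici _ hp hs,
      ← inner_integral_Ici _ hq hs] at hint
    rw [inner_sub_right, inner_add_right]
    linear_combination hint
  have heq (s : ℝ) (hs : 0 ≤ s) : ⟪x, y s⟫_ℂ =
      ⟪x, y 0⟫_ℂ + (⟪x, ∫ r in (0 : ℝ)..s, p r⟫_ℂ - ⟪z, ∫ r in (0 : ℝ)..s, q r⟫_ℂ) := by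
    have hcomm := inner_comm_of_forall_inner_eq ((hT x z).1 hxz) (hcoord s hs)
    rw [inner_sub_right, inner_add_right] at hcomm
    linear_combination hcomm
  exact (((hasDerivWithinAt_inner_integral x hp ht).sub
    (hasDerivWithinAt_inner_integral z hq ht)).const_add _).congr heq (heq t ht)

theorem IsModalSolution.hasDerivWithinAt_inner {lam : ι → ℝ} {δ : ℝ} {f : ℝ → E} {y₀ : E}
    (hne : ∀ i, muPlus δ (lam i) ≠ muMinus δ (lam i)) (hf : ContinuousOn f (Ici 0))
    (hy : IsModalSolution b lam δ f y₀ y) (i : ι) (ht : 0 ≤ t) :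
    HasDerivWithinAt (fun s => ⟪b i, y s⟫_ℂ)
      (⟪b i, f t⟫_ℂ - lam i * ⟪b i, y t + duhamel δ 0 y t⟫_ℂ) (Ici 0) t := by
  have heq : EqOn (fun s => ⟪b i, y s⟫_ℂ)
      (mode δ (lam i) ⟪b i, y₀⟫_ℂ fun s => ⟪b i, f s⟫_ℂ) (Ici 0) := fun s hs => hy.inner_eq s hs i
  have hd := (hasDerivWithinAt_mode (a := ⟪b i, y₀⟫_ℂ) (hne i)
    (continuousOn_const.inner hf) ht).congr heq (heq ht)
  rwa [← heq ht, ← duhamel_congr heq ht, ← inner_zero_right (b i), ← inner_duhamel hy.cont _ _ _ ht,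
    ← inner_add_right] at hd

end ModalCalculus

section Solutions

open Set

variable {H ι : Type*} [NormedAddCommGroup H] [InnerProductSpace ℝ H]
  {A : H →ₗ.[ℝ] H} {B : H →L[ℝ] H} {b : HilbertBasis ι ℂ (Complexification H)} {lam : ι → ℝ}
  {δ : ℝ} {β : ℝ → ℝ} {u : ℝ → Complexification H} {y₀ : Complexification H}
  {y : ℝ → Complexification H}

theorem IsWeakSolution.isModalSolution (hb : IsDiagonalIn (mapPMap A) b lam)
    (hβ : ∀ t, β t = Real.exp (-δ * t)) (hne : ∀ i, muPlus δ (lam i) ≠ muMinus δ (lam i))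
    (hf : ContinuousOn (fun t => mapCLM B (u t)) (Ici 0)) (hy : IsWeakSolution A B β u y₀ y) :
    IsModalSolution b lam δ (fun t => mapCLM B (u t)) y₀ y where
  cont := hy.cont
  inner_eq t ht i := by
    refine eqOn_mode (x := fun s => ⟪b i, y s⟫_ℂ) (hne i) (continuousOn_const.inner hf)
      (by rw [hy.init]) (fun s hs => ?_) ht
    have hgraph : (b i, (lam i : ℂ) • b i) ∈ (mapPMap A).graph := hb.mem_graph i
    obtain ⟨φ, hφ, hAφ⟩ := (LinearPMap.mem_graph_iff _).1 hgraph
    have hd := hy.eqn φ s hs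
    simp only [hφ, hAφ, inner_smul_left, Complex.conj_ofReal] at hd
    refine hd.congr_deriv ?_
    rw [mul_add, ← sub_sub, ← integral_smul_eq_duhamel hβ, ← intervalIntegral.integral_const_mul]
    simp only [smul_eq_mul, mul_left_comm]

variable [CompleteSpace H]

theorem IsModalSolution.isWeakSolution (hb : IsDiagonalIn (mapPMap A) b lam)
    (hβ : ∀ t, β t = Real.exp (-δ * t)) (hne : ∀ i, muPlus δ (lam i) ≠ muMinus δ (lam i))
    (hf : ContinuousOn (fun t => mapCLM B (u t)) (Ici 0))
    (hy : IsModalSolution b lam δ (fun t => mapCLM B (u t)) y₀ y) :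
    IsWeakSolution A B β u y₀ y where
  cont := hy.cont
  init := hy.init hne
  eqn φ t ht := by
    have hd := hb.hasDerivWithinAt_inner hf (hy.cont.add (continuousOn_duhamel δ 0 hy.cont))
      (fun i t ht => hy.hasDerivWithinAt_inner hne hf i ht) ((mapPMap A).mem_graph φ) ht
    rwa [Pi.add_apply, inner_add_right, inner_duhamel hy.cont _ _ _ ht, inner_zero_right,
      ← integral_smul_eq_duhamel hβ, ← sub_sub] at hd

theorem IsModalSolution.isClassicalSolution (hb : IsDiagonalIn (mapPMap A) b lam)
    (hβ : ∀ t, β t = Real.exp (-δ * t)) (hne : ∀ i, muPlus δ (lam i) ≠ muMinus δ (lam i))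
    (hf : ContinuousOn (fun t => mapCLM B (u t)) (Ici 0))
    (hy : IsModalSolution b lam δ (fun t => mapCLM B (u t)) y₀ y) {c : ι → ℝ}
    (hc : Summable fun i => c i ^ 2)
    (hle : ∀ i t, 0 ≤ t → ‖(lam i : ℂ) * ⟪b i, y t⟫_ℂ‖ ≤ c i) :
    IsClassicalSolution A B β u y₀ y := by
  obtain ⟨z, hz, hzy⟩ := exists_continuousOn_inner_eq b (s := Ici 0) hc
    (fun i => (continuousOn_const.inner hy.cont).const_mul (lam i : ℂ)) hle
  have hduhamel (i : ι) {t : ℝ} (ht : 0 ≤ t) :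
      ⟪b i, duhamel δ 0 z t⟫_ℂ = lam i * ⟪b i, duhamel δ 0 y t⟫_ℂ := by
    have h := inner_duhamel hy.cont δ ((lam i : ℂ) • b i) 0 ht
    simp only [inner_smul_left, Complex.conj_ofReal, inner_zero_right] at h
    rw [h, inner_duhamel hz _ _ _ ht, inner_zero_right]
    exact duhamel_congr (fun s hs => hzy s hs i) ht
  have hderiv (t : ℝ) (ht : 0 ≤ t) :
      HasDerivWithinAt y (mapCLM B (u t) - z t - duhamel δ 0 z t) (Ici 0) t := by
    refine hasDerivWithinAt_of_inner (b := b) ((hf.sub hz).sub (continuousOn_duhamel δ 0 hz))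
      (fun i s hs => ?_) ht
    convert hy.hasDerivWithinAt_inner hne hf i hs using 1
    rw [Pi.sub_apply, Pi.sub_apply, inner_sub_right, inner_sub_right, hduhamel i hs,
      hzy s hs, inner_add_right]
    ring
  refine ⟨hy.init hne, ?_, z, hz, fun t ht => ⟨?_, ?_⟩⟩
  · rw [contDiffOn_one_iff_derivWithin (uniqueDiffOn_Ici 0)]
    exact ⟨fun t ht => (hderiv t ht).differentiableWithinAt,
      ((hf.sub hz).sub (continuousOn_duhamel δ 0 hz)).congr fun t ht =>
        (hderiv t ht).derivWithin (uniqueDiffOn_Ici 0 t ht)⟩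
  · have hgraph : (y t, z t) ∈ (mapPMap A).graph := (hb _ _).2 fun i => hzy t ht i
    exact ⟨LinearPMap.mem_domain_of_mem_graph hgraph, (LinearPMap.image_iff _).2 hgraph⟩
  · simpa only [← integral_smul_eq_duhamel hβ, Complex.coe_smul] using hderiv t ht

end Solutions

section SquareSummable

variable {ι : Type*} {f g : ι → ℝ}

theorem summable_sq_add (hf : Summable fun i => f i ^ 2) (hg : Summable fun i => g i ^ 2) :
    Summable fun i => (f i + g i) ^ 2 :=
  ((hf.add hg).mul_left 2).of_nonneg_of_le (fun _ => sq_nonneg _) fun _ => add_sq_le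

theorem summable_sq_const_mul (c : ℝ) (hf : Summable fun i => f i ^ 2) :
    Summable fun i => (c * f i) ^ 2 := by
  simpa only [mul_pow] using hf.mul_left (c ^ 2)

theorem tsum_sq_add_le (hf : Summable fun i => f i ^ 2) (hg : Summable fun i => g i ^ 2) :
    ∑' i, (f i + g i) ^ 2 ≤ 2 * (∑' i, f i ^ 2 + ∑' i, g i ^ 2) := by
  rw [← hf.tsum_add hg, ← tsum_mul_left]
  exact (summable_sq_add hf hg).tsum_le_tsum (fun _ => add_sq_le) ((hf.add hg).mul_left 2)

end SquareSummable

section Stabilization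

open Set

variable {E ι : Type*} [NormedAddCommGroup E] [InnerProductSpace ℂ E]

/-- The force `f`, acting until the time `T` and with coordinates dominated by `F`, annihilates at
time `T` every mode of the trajectory from `y₀` that need not decay at the rate `γ` by itself. -/
structure IsStabilizingForce (b : HilbertBasis ι ℂ E) (lam : ι → ℝ) (δ γ T : ℝ) (F : ι → ℝ)
    (y₀ : E) (f : ℝ → E) : Prop where
  continuousOn : ContinuousOn f (Ici 0)
  eq_zero : ∀ t, T ≤ t → f t = 0
  norm_inner_le : ∀ i t, ‖⟪b i, f t⟫_ℂ‖ ≤ F i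
  summable : Summable fun i => F i ^ 2
  moment : ∀ i, γ ≤ (muMinus δ (lam i)).re ∨ ∀ μ, IsExponent δ (lam i) μ →
    ⟪b i, y₀⟫_ℂ + ∫ s in (0 : ℝ)..T, Complex.exp (μ * s) * ⟪b i, f s⟫_ℂ = 0

namespace IsStabilizingForce

variable {b : HilbertBasis ι ℂ E} {lam : ι → ℝ} {δ γ T C t : ℝ} {F : ι → ℝ} {y₀ : E} {f : ℝ → E}
  {y : ℝ → E}

theorem norm_mode_le (hf : IsStabilizingForce b lam δ γ T F y₀ f) (hδ : 0 < δ) (hγ : 0 < γ)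
    (hT : 0 ≤ T) (hlam : ∀ i, 0 < lam i) (hC : ∀ i, IsCoefBound C δ (lam i)) (i : ι)
    (ht : 0 ≤ t) :
    ‖mode δ (lam i) ⟪b i, y₀⟫_ℂ (fun s => ⟪b i, f s⟫_ℂ) t‖ ≤
      Real.exp (-γ * t) * (2 * C * Real.exp (γ * T)) * (‖⟪b i, y₀⟫_ℂ‖ + T * F i) :=
  PIDE.norm_mode_le (hC i) hδ (hlam i) hT hγ (continuousOn_const.inner hf.continuousOn)
    (hf.norm_inner_le i) (fun s hs => by rw [hf.eq_zero s hs, inner_zero_right]) (hf.moment i) ht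

theorem summable_sq_add (hf : IsStabilizingForce b lam δ γ T F y₀ f) :
    Summable fun i => (‖⟪b i, y₀⟫_ℂ‖ + T * F i) ^ 2 :=
  PIDE.summable_sq_add (hasSum_sq_norm_inner b y₀).summable (summable_sq_const_mul T hf.summable)

theorem tsum_sq_add_le {K : ℝ} (hf : IsStabilizingForce b lam δ γ T F y₀ f) (hT : 0 ≤ T)
    (hK : 0 ≤ K) (hFK : ∑' i, F i ^ 2 ≤ K ^ 2) :
    ∑' i, (‖⟪b i, y₀⟫_ℂ‖ + T * F i) ^ 2 ≤ (2 * (‖y₀‖ + T * K)) ^ 2 := by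
  have hy₀ := hasSum_sq_norm_inner b y₀
  have hsum := PIDE.tsum_sq_add_le hy₀.summable (summable_sq_const_mul T hf.summable)
  simp only [mul_pow T, tsum_mul_left, hy₀.tsum_eq] at hsum
  have hTK : T ^ 2 * ∑' i, F i ^ 2 ≤ T ^ 2 * K ^ 2 := mul_le_mul_of_nonneg_left hFK (sq_nonneg T)
  nlinarith [mul_nonneg (norm_nonneg y₀) (mul_nonneg hT hK), sq_nonneg ‖y₀‖, sq_nonneg (T * K)]

theorem exists_isModalSolution [CompleteSpace E] (hf : IsStabilizingForce b lam δ γ T F y₀ f)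
    (hδ : 0 < δ) (hγ : 0 < γ) (hT : 0 ≤ T) (hlam : ∀ i, 0 < lam i)
    (hC : ∀ i, IsCoefBound C δ (lam i)) : ∃ y, IsModalSolution b lam δ f y₀ y := by
  obtain ⟨y, hyc, hy⟩ := exists_continuousOn_inner_eq b (s := Ici 0)
    (Y := fun i => mode δ (lam i) ⟪b i, y₀⟫_ℂ fun s => ⟪b i, f s⟫_ℂ)
    (summable_sq_const_mul (2 * C * Real.exp (γ * T)) hf.summable_sq_add)
    (fun i => continuousOn_mode (continuousOn_const.inner hf.continuousOn)) fun i t ht => by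
      have hF : 0 ≤ F i := (norm_nonneg _).trans (hf.norm_inner_le i 0)
      have hC₀ : 0 ≤ C := (norm_nonneg _).trans (hC i).norm_coefPlus_le
      refine (hf.norm_mode_le hδ hγ hT hlam hC i ht).trans ?_
      rw [mul_assoc]
      refine mul_le_of_le_one_left (by positivity) (Real.exp_le_one_iff.2 ?_)
      exact mul_nonpos_of_nonpos_of_nonneg (neg_nonpos.2 hγ.le) ht
  exact ⟨y, hyc, hy⟩

theorem norm_le {K : ℝ} (hf : IsStabilizingForce b lam δ γ T F y₀ f) (hδ : 0 < δ) (hγ : 0 < γ)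
    (hT : 0 ≤ T) (hlam : ∀ i, 0 < lam i) (hC₀ : 0 ≤ C) (hC : ∀ i, IsCoefBound C δ (lam i))
    (hK : 0 ≤ K) (hFK : ∑' i, F i ^ 2 ≤ K ^ 2) (hy : IsModalSolution b lam δ f y₀ y)
    (ht : 0 ≤ t) : ‖y t‖ ≤ 4 * C * Real.exp (γ * T) * (‖y₀‖ + T * K) * Real.exp (-γ * t) := by
  refine abs_le_of_sq_le_sq' ?_ (by positivity) |>.2
  calc ‖y t‖ ^ 2
    _ ≤ ∑' i, (Real.exp (-γ * t) * (2 * C * Real.exp (γ * T)) *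
          (‖⟪b i, y₀⟫_ℂ‖ + T * F i)) ^ 2 :=
      norm_sq_le_tsum b (summable_sq_const_mul _ hf.summable_sq_add) fun i => by
        rw [hy.inner_eq t ht i]
        exact hf.norm_mode_le hδ hγ hT hlam hC i ht
    _ = (Real.exp (-γ * t) * (2 * C * Real.exp (γ * T))) ^ 2 *
          ∑' i, (‖⟪b i, y₀⟫_ℂ‖ + T * F i) ^ 2 := by
      simp only [mul_pow (Real.exp (-γ * t) * (2 * C * Real.exp (γ * T))), tsum_mul_left]
    _ ≤ (Real.exp (-γ * t) * (2 * C * Real.exp (γ * T))) ^ 2 * (2 * (‖y₀‖ + T * K)) ^ 2 :=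
      mul_le_mul_of_nonneg_left (hf.tsum_sq_add_le hT hK hFK) (sq_nonneg _)
    _ = _ := by ring

theorem exists_summable_norm_le {S : E →ₗ.[ℂ] E} (hS : IsDiagonalIn S b lam)
    (hf : IsStabilizingForce b lam δ γ T F y₀ f) (hδ : 0 < δ) (hT : 0 ≤ T)
    (hlam : ∀ i, 0 < lam i) (hC : ∀ i, IsCoefBound C δ (lam i)) (hy₀ : y₀ ∈ S.domain)
    (hy : IsModalSolution b lam δ f y₀ y) :
    ∃ c : ι → ℝ, (Summable fun i => c i ^ 2) ∧
      ∀ i t, 0 ≤ t → ‖(lam i : ℂ) * ⟪b i, y t⟫_ℂ‖ ≤ c i := by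
  have hnorm (i : ι) (x : ℂ) : ‖(lam i : ℂ) * x‖ = lam i * ‖x‖ := by
    rw [norm_mul, Complex.norm_real, Real.norm_of_nonneg (hlam i).le]
  have hSy₀ : Summable fun i => (lam i * ‖⟪b i, y₀⟫_ℂ‖) ^ 2 := by
    have hgraph (i : ι) : ⟪b i, S ⟨y₀, hy₀⟩⟫_ℂ = (lam i : ℂ) * ⟪b i, y₀⟫_ℂ :=
      (hS _ _).1 (S.mem_graph ⟨y₀, hy₀⟩) i
    simpa only [hgraph, hnorm] using (hasSum_sq_norm_inner b (S ⟨y₀, hy₀⟩)).summable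
  refine ⟨fun i => C * (lam i * ‖⟪b i, y₀⟫_ℂ‖ + C * F i) + C * (‖⟪b i, y₀⟫_ℂ‖ + T * F i),
    PIDE.summable_sq_add (summable_sq_const_mul C (PIDE.summable_sq_add hSy₀
      (summable_sq_const_mul C hf.summable))) (summable_sq_const_mul C hf.summable_sq_add),
    fun i t ht => ?_⟩
  rw [hnorm, hy.inner_eq t ht]
  exact mul_norm_mode_le (hC i) hδ (hlam i) hT (continuousOn_const.inner hf.continuousOn)
    (hf.norm_inner_le i) (fun s hs => by rw [hf.eq_zero s hs, inner_zero_right]) ht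

end IsStabilizingForce

variable {H : Type*} [NormedAddCommGroup H] [InnerProductSpace ℝ H] [CompleteSpace H]
  {A : H →ₗ.[ℝ] H} {B : H →L[ℝ] H} {b : HilbertBasis ι ℂ (Complexification H)} {lam : ι → ℝ}
  {δ : ℝ} {β : ℝ → ℝ} {u : ℝ → Complexification H} {y₀ : Complexification H}

theorem IsStabilizingForce.steers {γ T C K : ℝ} {F : ι → ℝ}
    (hf : IsStabilizingForce b lam δ γ T F y₀ fun t => mapCLM B (u t))
    (hb : IsDiagonalIn (mapPMap A) b lam) (hβ : ∀ t, β t = Real.exp (-δ * t)) (hδ : 0 < δ)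
    (hγ : 0 < γ) (hT : 0 ≤ T) (hlam : ∀ i, 0 < lam i)
    (hne : ∀ i, muPlus δ (lam i) ≠ muMinus δ (lam i)) (hC₀ : 0 ≤ C)
    (hC : ∀ i, IsCoefBound C δ (lam i)) (hK : 0 ≤ K) (hFK : ∑' i, F i ^ 2 ≤ (K * ‖y₀‖) ^ 2) :
    Steers A B β γ (4 * C * Real.exp (γ * T) * (1 + T * K)) y₀ u := by
  obtain ⟨y, hy⟩ := hf.exists_isModalSolution hδ hγ hT hlam hC
  refine ⟨y, hy.isWeakSolution hb hβ hne hf.continuousOn,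
    fun y' hy' => (hy'.isModalSolution hb hβ hne hf.continuousOn).eqOn hy, fun hy₀ => ?_,
    fun t ht => ?_⟩
  · obtain ⟨c, hc, hle⟩ := hf.exists_summable_norm_le hb hδ hT hlam hC hy₀ hy
    exact hy.isClassicalSolution hb hβ hne hf.continuousOn hc hle
  · refine (hf.norm_le hδ hγ hT hlam hC₀ hC (by positivity) hFK hy ht).trans (le_of_eq ?_)
    ring

end Stabilization

section Rank

theorem mulVec_surjective_of_card_le_rank {K m n : Type*} [Field K] [Fintype m] [Fintype n]
    {Q : Matrix m n K} (h : Fintype.card m ≤ Q.rank) : Function.Surjective Q.mulVec :=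
  LinearMap.range_eq_top.1 <| Submodule.eq_top_of_finrank_eq (S := LinearMap.range Q.mulVecLin) <|
    le_antisymm (Submodule.finrank_le _) (by rwa [Module.finrank_fintype_fun_eq_card])

variable {H : Type*} [NormedAddCommGroup H] [InnerProductSpace ℝ H] {B : H →L[ℝ] H} {lam : ℕ → ℝ}
  {φs : ℕ → H} {δ Λ : ℝ} {N M : ℕ} {R : Matrix (Fin N ⊕ Fin N) (Fin N ⊕ Fin N) ℂ}

/-- The rows of `C_{NM}` belonging to the eigenvalue `Λ`. -/
def blockC (B : H →L[ℝ] H) (lam : ℕ → ℝ) (φs : ℕ → H) (N M : ℕ) (Λ : ℝ) :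
    Matrix {j : Fin N // lam j = Λ} (Fin M) ℂ :=
  (matC B φs N M).submatrix Subtype.val id

/-- The rank condition without reference to a diagonalization of `P_{2N}`: the rows of `C_{NM}`
belonging to one and the same eigenvalue are linearly independent. -/
def BlockRankCondition (B : H →L[ℝ] H) (lam : ℕ → ℝ) (φs : ℕ → H) (N M : ℕ) : Prop :=
  ∀ k : Fin N, (blockC B lam φs N M (lam k)).rank = mult lam N (lam k)

theorem BlockRankCondition.exists_mulVec_eq (h : BlockRankCondition B lam φs N M) (j : Fin N) :
    ∃ U : Fin M → ℂ, ∀ k : Fin N, lam k = lam j →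
      (matC B φs N M).mulVec U k = if k = j then 1 else 0 := by
  classical
  have hcard : Fintype.card {k : Fin N // lam k = lam j} ≤ (blockC B lam φs N M (lam j)).rank := by
    rw [h j, mult, Nat.card_eq_fintype_card]
  obtain ⟨U, hU⟩ := mulVec_surjective_of_card_le_rank hcard (Pi.single ⟨j, rfl⟩ 1)
  refine ⟨U, fun k hk => ?_⟩
  have hk' : (matC B φs N M).mulVec U k = _ := congrFun hU ⟨k, hk⟩
  simpa only [Pi.single_apply, Subtype.mk.injEq] using hk'

/-- Row `k` of `R` is a left eigenvector of `P_{2N}` for `-μ_k^+`, and a nonzero entry above `m`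
would make `μ_k^+` an exponent of `lam m` as well. -/
theorem apply_inl_inr_eq_zero (hδ : 0 < δ) (hRP : R * matP δ lam N = matD δ lam N * R)
    {k m : Fin N} (h : lam m ≠ lam k) : R (Sum.inl k) (Sum.inr m) = 0 := by
  have hinl := congrFun (congrFun hRP (Sum.inl k)) (Sum.inl m)
  have hinr := congrFun (congrFun hRP (Sum.inl k)) (Sum.inr m)
  rw [matD, Matrix.diagonal_mul] at hinl hinr
  simp only [matP, Matrix.mul_apply, Fintype.sum_sum_type,
    Matrix.fromBlocks_apply₁₁, Matrix.fromBlocks_apply₂₁, Matrix.fromBlocks_apply₁₂,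
    Matrix.fromBlocks_apply₂₂, Matrix.zero_apply, Matrix.neg_apply, Matrix.diagonal_apply,
    Matrix.one_apply, Sum.elim_inl, mul_zero, Finset.sum_const_zero, zero_add, mul_neg, mul_ite,
    mul_one, Finset.sum_neg_distrib, Finset.sum_ite_eq', Finset.mem_univ, if_true] at hinl hinr
  push_cast at hinl hinr
  by_contra hR
  refine h (IsExponent.unique hδ (mul_left_cancel₀ hR ?_) (isExponent_muPlus δ (lam k)))
  linear_combination -hinl + muPlus δ (lam k) * hinr

open scoped ComplexOrder Matrix in
theorem blockPlus_eq_conjTranspose_mul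
    (hR : ∀ k m : Fin N, lam k = Λ → lam m ≠ Λ → R (Sum.inl k) (Sum.inr m) = 0) :
    blockPlus (R * matQ B φs N M)ᴴ lam Λ =
      (R.submatrix (fun k : {k : Fin N // lam k = Λ} => Sum.inl k.1) (fun m => Sum.inr m.1) *
        blockC B lam φs N M Λ)ᴴ := by
  classical
  ext i k
  simp only [blockPlus, blockC, Matrix.submatrix_apply, id_eq, Matrix.conjTranspose_apply,
    Matrix.mul_apply, Fintype.sum_sum_type, matQ, Matrix.fromRows_apply_inl,
    Matrix.fromRows_apply_inr, Matrix.zero_apply, mul_zero, Finset.sum_const_zero, zero_add]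
  refine congrArg star <| (Finset.sum_filter_of_ne (p := fun m : Fin N => lam m = Λ)
    fun m _ hm => ?_).symm.trans (Finset.sum_subtype _ (fun m => Finset.mem_filter_univ m) _)
  by_contra hne
  exact hm (by rw [hR k m k.2 hne, zero_mul])

open scoped ComplexOrder in
theorem RankCondition.blockRankCondition (h : RankCondition B lam φs N M R) (hδ : 0 < δ)
    (hR : IsUnit R) (hRP : matP δ lam N = R⁻¹ * matD δ lam N * R) :
    BlockRankCondition B lam φs N M := by
  classical
  intro k
  have hRP' : R * matP δ lam N = matD δ lam N * R := by
    rw [hRP, Matrix.mul_assoc, ← Matrix.mul_assoc R,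
      Matrix.mul_nonsing_inv _ ((Matrix.isUnit_iff_isUnit_det R).1 hR), Matrix.one_mul]
  have hrank := (h k).1
  rw [blockPlus_eq_conjTranspose_mul fun j m hj hm =>
    apply_inl_inr_eq_zero hδ hRP' (by rwa [hj]), Matrix.rank_conjTranspose] at hrank
  refine le_antisymm ?_ (hrank ▸ Matrix.rank_mul_le_right _ _)
  rw [mult, Nat.card_eq_fintype_card]
  exact Matrix.rank_le_card_height _

end Rank

section Amplitude

open Finset

theorem exists_testFunction_integral_cexp_eq_ite {J : Type*} [Finite J] {δ T : ℝ} (hδ : 0 < δ)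
    (hT : 0 < T) (Λ : J → ℝ) (j : J) :
    ∃ θ ∈ testFunctions T, ∀ k μ, IsExponent δ (Λ k) μ →
      ∫ s in (0 : ℝ)..T, Complex.exp (μ * s) * θ s = if Λ k = Λ j then 1 else 0 := by
  classical
  have := Fintype.ofFinite J
  obtain ⟨θ, hθ, hint⟩ := exists_testFunction_integral_cexp_eq hT
    (univ.image (fun k => muPlus δ (Λ k)) ∪ univ.image fun k => muMinus δ (Λ k))
    fun μ => if IsExponent δ (Λ j) μ then 1 else 0
  refine ⟨θ, hθ, fun k μ hμ => ?_⟩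
  have hmem : μ ∈ univ.image (fun k => muPlus δ (Λ k)) ∪ univ.image fun k => muMinus δ (Λ k) := by
    simp only [mem_union, mem_image, mem_univ, true_and]
    exact (isExponent_iff.1 hμ).imp (fun h => ⟨k, h.symm⟩) fun h => ⟨k, h.symm⟩
  rw [hint μ hmem]
  exact if_congr ⟨hμ.unique hδ, fun h => h ▸ hμ⟩ rfl rfl

variable {J κ : Type*} [Fintype J]

/-- The control amplitudes `v_i = -∑ⱼ aⱼ U_{ji} θⱼ`, meant to annihilate coordinates with initial
values `aⱼ`: the input vector `U j` acts on the `j`-th coordinate, with time profile `θ j`. -/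
def amplitude (a : J → ℂ) (U : J → κ → ℂ) (θ : J → ℝ → ℂ) (t : ℝ) (i : κ) : ℂ :=
  -∑ j, a j * U j i * θ j t

variable {a : J → ℂ} {U : J → κ → ℂ} {θ : J → ℝ → ℂ} {T : ℝ}

theorem amplitude_mem_testFunctions (a : J → ℂ) (U : J → κ → ℂ)
    (hθ : ∀ j, θ j ∈ testFunctions T) (i : κ) :
    (fun t => amplitude a U θ t i) ∈ testFunctions T := by
  have hmem := neg_mem (sum_mem fun j (_ : j ∈ univ) =>
    (testFunctions T).smul_mem (a j * U j i) (hθ j))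
  convert hmem using 1
  ext t
  simp only [amplitude, Pi.neg_apply, Finset.sum_apply, Pi.smul_apply, smul_eq_mul]

theorem deriv_amplitude (a : J → ℂ) (U : J → κ → ℂ) (hθ : ∀ j, θ j ∈ testFunctions T) (i : κ) :
    (deriv fun t => amplitude a U θ t i) = fun t => amplitude a U (fun j => deriv (θ j)) t i :=
  funext fun t => (HasDerivAt.fun_sum fun j _ =>
    (testFunctions.hasDerivAt (hθ j) t).const_mul (a j * U j i)).neg.deriv

theorem norm_amplitude_le [Fintype κ] {q r t : ℝ} (ha : ∀ j, ‖a j‖ ≤ r) (hθ : ∀ j, ‖θ j t‖ ≤ q)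
    (i : κ) : ‖amplitude a U θ t i‖ ≤ (∑ j, ∑ i, ‖U j i‖) * q * r := by
  rw [amplitude, norm_neg, sum_mul, sum_mul]
  refine norm_sum_le_of_le _ fun j _ => ?_
  have hq : 0 ≤ q := (norm_nonneg _).trans (hθ j)
  calc ‖a j * U j i * θ j t‖
    _ = ‖U j i‖ * ‖θ j t‖ * ‖a j‖ := by rw [norm_mul, norm_mul]; ring
    _ ≤ (∑ i, ‖U j i‖) * q * r := by
      gcongr
      · exact single_le_sum (f := fun i => ‖U j i‖) (fun i _ => norm_nonneg _) (mem_univ i)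
      · exact hθ j
      · exact ha j

theorem exists_amplitude_bound [Finite κ] (U : J → κ → ℂ) (hθ : ∀ j, θ j ∈ testFunctions T) :
    ∃ c, 0 ≤ c ∧ ∀ (a : J → ℂ) (r : ℝ), (∀ j, ‖a j‖ ≤ r) → ∀ i t,
      ‖amplitude a U θ t i‖ ≤ c * r ∧ ‖deriv (fun s => amplitude a U θ s i) t‖ ≤ c * r ∧
        ‖deriv (deriv fun s => amplitude a U θ s i) t‖ ≤ c * r := by
  have := Fintype.ofFinite κ
  choose q hq₀ hq using fun j => testFunctions.exists_bound (hθ j)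
  have hle (j : J) : q j ≤ ∑ j, q j := single_le_sum (fun j _ => (hq₀ j).le) (mem_univ j)
  refine ⟨(∑ j, ∑ i, ‖U j i‖) * ∑ j, q j, mul_nonneg
    (sum_nonneg fun j _ => sum_nonneg fun i _ => norm_nonneg _)
    (sum_nonneg fun j _ => (hq₀ j).le), fun a r ha i t => ?_⟩
  rw [deriv_amplitude a U hθ, deriv_amplitude a U fun j => testFunctions.deriv_mem (hθ j)]
  exact ⟨norm_amplitude_le ha (fun j => (hq j t).1.trans (hle j)) i,
    norm_amplitude_le ha (fun j => (hq j t).2.1.trans (hle j)) i,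
    norm_amplitude_le ha (fun j => (hq j t).2.2.trans (hle j)) i⟩

theorem sum_amplitude_mul [Fintype κ] (a : J → ℂ) (U : J → κ → ℂ) (θ : J → ℝ → ℂ) (t : ℝ)
    (x : κ → ℂ) :
    ∑ i, amplitude a U θ t i * x i = -∑ j, a j * (∑ i, U j i * x i) * θ j t := by
  simp only [amplitude, neg_mul, sum_neg_distrib, sum_mul, mul_sum]
  rw [sum_comm]
  exact congrArg Neg.neg (sum_congr rfl fun j _ => sum_congr rfl fun i _ => by ring)

theorem integral_cexp_mul_sum_amplitude [Fintype κ] (a : J → ℂ) (U : J → κ → ℂ)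
    (hθ : ∀ j, θ j ∈ testFunctions T) (μ : ℂ) (x : κ → ℂ) :
    ∫ s in (0 : ℝ)..T, Complex.exp (μ * s) * ∑ i, amplitude a U θ s i * x i =
      -∑ j, a j * (∑ i, U j i * x i) * ∫ s in (0 : ℝ)..T, Complex.exp (μ * s) * θ j s := by
  have hc (j : J) : Continuous (θ j) := testFunctions.continuous (hθ j)
  simp only [sum_amplitude_mul, mul_neg, mul_sum, mul_left_comm (Complex.exp _)]
  rw [intervalIntegral.integral_neg, intervalIntegral.integral_finsetSum fun j _ =>
    Continuous.intervalIntegrable (by fun_prop) _ _]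
  simp only [intervalIntegral.integral_const_mul]

end Amplitude

section FiniteRankForce

variable {E ι J κ : Type*} [NormedAddCommGroup E] [InnerProductSpace ℂ E] [Fintype J] [Fintype κ]
  {b : HilbertBasis ι ℂ E} {lam : ι → ℝ} {e : J → ι} {g : κ → E} {a : J → ℂ} {U : J → κ → ℂ}
  {θ : J → ℝ → ℂ} {δ γ T c : ℝ} {y₀ : E}

theorem summable_sq_sum_norm_inner (b : HilbertBasis ι ℂ E) (g : κ → E) :
    Summable fun n => (∑ i, ‖⟪b n, g i⟫_ℂ‖) ^ 2 := by
  refine ((summable_sum fun i (_ : i ∈ Finset.univ) =>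
    (hasSum_sq_norm_inner b (g i)).summable).mul_left (Fintype.card κ : ℝ)).of_nonneg_of_le
    (fun n => sq_nonneg _) fun n => ?_
  exact sq_sum_le_card_mul_sum_sq (s := Finset.univ) (f := fun i => ‖⟪b n, g i⟫_ℂ‖)

theorem isStabilizingForce_amplitude [DecidableEq J]
    (he : ∀ n, γ ≤ (muMinus δ (lam n)).re ∨ n ∈ Set.range e)
    (hU : ∀ j k, lam (e k) = lam (e j) → ∑ i, U j i * ⟪b (e k), g i⟫_ℂ = if k = j then 1 else 0)
    (hθ : ∀ j, θ j ∈ testFunctions T)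
    (hint : ∀ j k μ, IsExponent δ (lam (e k)) μ →
      ∫ s in (0 : ℝ)..T, Complex.exp (μ * s) * θ j s = if lam (e k) = lam (e j) then 1 else 0)
    (hc : ∀ i t, ‖amplitude (fun j => ⟪b (e j), y₀⟫_ℂ) U θ t i‖ ≤ c) :
    IsStabilizingForce b lam δ γ T (fun n => c * ∑ i, ‖⟪b n, g i⟫_ℂ‖) y₀
      fun t => ∑ i, amplitude (fun j => ⟪b (e j), y₀⟫_ℂ) U θ t i • g i where
  continuousOn := (continuous_finsetSum _ fun i _ => (testFunctions.continuous
    (amplitude_mem_testFunctions _ U hθ i)).smul continuous_const).continuousOn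
  eq_zero t ht := Finset.sum_eq_zero fun i _ => by
    rw [testFunctions.eq_zero_of_notMem_Ioo (amplitude_mem_testFunctions _ U hθ i) (t := t)
      fun h => h.2.not_ge ht, zero_smul]
  norm_inner_le n t := by
    simp only [inner_sum, inner_smul_right, Finset.mul_sum]
    exact norm_sum_le_of_le _ fun i _ => (norm_mul _ _).trans_le <|
      mul_le_mul_of_nonneg_right (hc i t) (norm_nonneg _)
  summable := summable_sq_const_mul c (summable_sq_sum_norm_inner b g)
  moment n := (he n).imp_right <| by
    rintro ⟨k, rfl⟩ μ hμ
    simp only [inner_sum, inner_smul_right, integral_cexp_mul_sum_amplitude _ U hθ, hint _ k μ hμ]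
    rw [Finset.sum_eq_single k, hU k k rfl, if_pos rfl, if_pos rfl, mul_one, mul_one,
      add_neg_cancel]
    · intro j _ hjk
      split_ifs with h
      · rw [hU j k h, if_neg hjk.symm, mul_zero, zero_mul]
      · rw [mul_zero]
    · exact fun h => absurd (Finset.mem_univ k) h

end FiniteRankForce

section Steering

variable {H : Type*} [NormedAddCommGroup H] [InnerProductSpace ℝ H] {A : H →ₗ.[ℝ] H}
  {B : H →L[ℝ] H} {lam : ℕ → ℝ} {φ φs : ℕ → H} {δ γ T C C' : ℝ} {β : ℝ → ℝ} {N M : ℕ}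
  {Φ : Fin M → H}

theorem mapCLM_control (B : H →L[ℝ] H) (Φ : Fin M → H) (v : ℝ → Fin M → ℂ) (t : ℝ) :
    mapCLM B (control Φ v t) = control (fun i => B (Φ i)) v t := by
  let L : Complexification H →+ Complexification H :=
    { toFun := mapCLM B
      map_zero' := by ext <;> simp [mapCLM]
      map_add' := fun x y => by ext <;> simp [mapCLM] }
  change L (∑ i, v t i • ofReal (Φ i)) = ∑ i, v t i • ofReal (B (Φ i))
  rw [map_sum]
  refine Finset.sum_congr rfl fun i _ => ?_
  change mapCLM B (v t i • ofReal (Φ i)) = _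
  ext <;> simp [mapCLM, ofReal, -Complex.coe_smul]

theorem Steers.mono {y₀ : Complexification H} {u : ℝ → Complexification H}
    (h : Steers A B β γ C y₀ u) (hC : C ≤ C') : Steers A B β γ C' y₀ u := by
  obtain ⟨y, hweak, hunique, hclassical, hle⟩ := h
  refine ⟨y, hweak, hunique, hclassical, fun t ht => (hle t ht).trans ?_⟩
  gcongr

theorem IsEigenSystem.eq_of_biorthogonal [CompleteSpace H] (hφ : IsEigenSystem A lam φ)
    (hA : IsSelfAdjoint A) (hcpt : HasCompactResolvent A)
    (hN : ∀ j n, j < N → lam n = lam j → n < N) (heig : ∀ j < N, IsEigenpair A (lam j) (φs j))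
    (hφs : ∀ i j, i < N → j < N → ⟪φ i, φs j⟫_ℝ = if i = j then 1 else 0) {j : ℕ} (hj : j < N) :
    φs j = φ j := by
  refine eq_of_forall_inner_eq (hφ.basis hA hcpt) fun n => ?_
  rw [hφ.coe_basis, orthonormal_iff_ite.1 hφ.orthonormal]
  by_cases hn : n < N
  · exact hφs n j hn hj
  · have hinner := (hφ.isDiagonalIn_basis hA hcpt _ _).1 (isEigenpair_iff_mem_graph.1 (heig j hj)) n
    rw [real_inner_smul_right, hφ.coe_basis] at hinner
    rw [if_neg (by omega)]
    exact (mul_eq_mul_right_iff.1 hinner).resolve_left fun h => hn (hN j n hj h.symm)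

/-- Every initial state is stabilized by a control `∑ i, v_i Φ_i` with smooth amplitudes supported
in `(0, T)` whose derivatives up to order two are bounded in terms of the initial state. -/
def SmoothlySteerable (A : H →ₗ.[ℝ] H) (B : H →L[ℝ] H) (β : ℝ → ℝ) (γ T C : ℝ) (Φ : Fin M → H) :
    Prop :=
  ∀ y₀ : Complexification H, ∃ v : ℝ → Fin M → ℂ,
    (∀ i, (fun t => v t i) ∈ testFunctions T) ∧
    (∀ i t, ‖v t i‖ ≤ C * ‖y₀‖ ∧ ‖deriv (fun s => v s i) t‖ ≤ C * ‖y₀‖ ∧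
      ‖deriv (deriv fun s => v s i) t‖ ≤ C * ‖y₀‖) ∧
    Steers A B β γ C y₀ (control Φ v)

theorem exists_smoothlySteerable [CompleteSpace H] {ι J : Type*} [Finite J] [DecidableEq J]
    {b : HilbertBasis ι ℂ (Complexification H)} {lam : ι → ℝ} {e : J → ι}
    (hb : IsDiagonalIn (mapPMap A) b lam) (hβ : ∀ t, β t = Real.exp (-δ * t)) (hδ : 0 < δ)
    (hγ : 0 < γ) (hT : 0 < T) (hlam : ∀ n, 0 < lam n)
    (hne : ∀ n, muPlus δ (lam n) ≠ muMinus δ (lam n)) (hC₀ : 0 < C)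
    (hC : ∀ n, IsCoefBound C δ (lam n))
    (he : ∀ n, γ ≤ (muMinus δ (lam n)).re ∨ n ∈ Set.range e)
    (hU : ∀ j, ∃ U : Fin M → ℂ, ∀ k, lam (e k) = lam (e j) →
      ∑ i, U i * ⟪b (e k), ofReal (B (Φ i))⟫_ℂ = if k = j then 1 else 0) :
    ∃ C, 0 < C ∧ SmoothlySteerable A B β γ T C Φ := by
  have := Fintype.ofFinite J
  choose U hU using hU
  choose θ hθ hint using exists_testFunction_integral_cexp_eq_ite hδ hT fun j => lam (e j)
  obtain ⟨c, hc, hbound⟩ := exists_amplitude_bound U hθ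
  set G : ι → ℝ := fun n => ∑ i, ‖⟪b n, ofReal (B (Φ i))⟫_ℂ‖
  set K := c * √(∑' n, G n ^ 2) with hK
  set C₁ := 4 * C * Real.exp (γ * T) * (1 + T * K)
  have hC₁ : 0 < C₁ := by positivity
  refine ⟨c + C₁, by positivity, fun y₀ => ?_⟩
  have ha (j : J) : ‖⟪b (e j), y₀⟫_ℂ‖ ≤ ‖y₀‖ := by
    simpa only [b.orthonormal.1, one_mul] using norm_inner_le_norm (𝕜 := ℂ) (b (e j)) y₀
  refine ⟨amplitude (fun j => ⟪b (e j), y₀⟫_ℂ) U θ, amplitude_mem_testFunctions _ U hθ,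
    fun i t => ?_, ?_⟩
  · have hle : c * ‖y₀‖ ≤ (c + C₁) * ‖y₀‖ := by gcongr; linarith
    obtain ⟨h₀, h₁, h₂⟩ := hbound _ _ ha i t
    exact ⟨h₀.trans hle, h₁.trans hle, h₂.trans hle⟩
  · have hforce : IsStabilizingForce b lam δ γ T (fun n => c * ‖y₀‖ * G n) y₀ fun t =>
        control (fun i => B (Φ i)) (amplitude (fun j => ⟪b (e j), y₀⟫_ℂ) U θ) t :=
      isStabilizingForce_amplitude he hU hθ hint fun i t => (hbound _ _ ha i t).1
    refine (IsStabilizingForce.steers (K := K) (by simpa only [mapCLM_control]) hb hβ hδ hγ hT.le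
      hlam hne hC₀.le hC (by positivity) ?_).mono (le_add_of_nonneg_left hc)
    simp only [mul_pow (c * ‖y₀‖), tsum_mul_left, hK]
    rw [mul_right_comm, mul_pow (c * ‖y₀‖), Real.sq_sqrt (tsum_nonneg fun n => sq_nonneg _)]

end Steering

section Controls

open MeasureTheory Set

theorem eq_neg_integral_of_hasDerivAt {δ T : ℝ} {β : ℝ → ℝ} (hβ : ∀ t, β t = Real.exp (-δ * t))
    {v v' : ℝ → ℂ} (hv : ∀ s, HasDerivAt v (v' s) s) (hv' : Continuous v') (hT : v T = 0) (t : ℝ) :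
    v t = -∫ s in t..T, (β (t - s) : ℂ) * (v' s + δ * v s) := by
  have hβc (s : ℝ) : (β (t - s) : ℂ) = Complex.exp (-δ * t) * Complex.exp (δ * s) := by
    rw [hβ, ← Complex.exp_add, Complex.ofReal_exp]
    congr 1
    push_cast
    ring
  have hvc : Continuous v := continuous_iff_continuousAt.2 fun s => (hv s).continuousAt
  have hderiv (s : ℝ) : HasDerivAt (fun s : ℝ => Complex.exp (δ * s) * v s)
      (Complex.exp (δ * s) * (v' s + δ * v s)) s :=
    ((hasDerivAt_cexp_mul (δ : ℂ) s).mul (hv s)).congr_deriv (by ring)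
  simp only [hβc, mul_assoc, intervalIntegral.integral_const_mul]
  rw [intervalIntegral.integral_eq_sub_of_hasDerivAt (fun s _ => hderiv s)
    (Continuous.intervalIntegrable (by fun_prop) _ _), hT, mul_zero, zero_sub, mul_neg, neg_neg,
    ← mul_assoc, cexp_neg_mul_cexp, one_mul]

variable {H : Type*} [NormedAddCommGroup H] [InnerProductSpace ℝ H] {A : H →ₗ.[ℝ] H}
  {B : H →L[ℝ] H} {δ γ T C : ℝ} {β : ℝ → ℝ} {M : ℕ} {Φ : Fin M → H}

namespace SmoothlySteerable

theorem exists_continuousOn (h : SmoothlySteerable A B β γ T C Φ) (y₀ : Complexification H) :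
    ∃ v : ℝ → Fin M → ℂ, ContinuousOn v (Ici 0) ∧ Steers A B β γ C y₀ (control Φ v) := by
  obtain ⟨v, hv, -, hsteers⟩ := h y₀
  exact ⟨v, (continuous_pi fun i => testFunctions.continuous (hv i)).continuousOn, hsteers⟩

theorem exists_eq_neg_integral (h : SmoothlySteerable A B β γ T C Φ)
    (hβ : ∀ t, β t = Real.exp (-δ * t)) (hδ : 0 ≤ δ) (y₀ : Complexification H) :
    ∃ v w : ℝ → Fin M → ℂ, Continuous v ∧ Continuous w ∧
      (∀ i t, v t i = -∫ s in t..T, (β (t - s) : ℂ) * w s i) ∧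
      (∀ i t, ‖w t i‖ ≤ (1 + δ) * C * ‖y₀‖) ∧
      (∀ i t, T ≤ t → v t i = 0 ∧ w t i = 0) ∧
      Steers A B β γ C y₀ (control Φ v) := by
  obtain ⟨v, hv, hle, hsteers⟩ := h y₀
  have hv' (i : Fin M) := testFunctions.deriv_mem (hv i)
  have hvc (i : Fin M) : Continuous fun t => v t i := testFunctions.continuous (hv i)
  have hwc (i : Fin M) : Continuous fun t => deriv (fun s => v s i) t + δ * v t i :=
    (testFunctions.continuous (hv' i)).add (continuous_const.mul (hvc i))
  have hv₀ (i : Fin M) {t : ℝ} (ht : T ≤ t) : v t i = 0 :=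
    testFunctions.eq_zero_of_notMem_Ioo (hv i) fun h => h.2.not_ge ht
  refine ⟨v, fun t i => deriv (fun s => v s i) t + δ * v t i, continuous_pi hvc, continuous_pi hwc,
    fun i => eq_neg_integral_of_hasDerivAt hβ (testFunctions.hasDerivAt (hv i))
      (testFunctions.continuous (hv' i)) (hv₀ i le_rfl),
    fun i t => ?_, fun i t ht => ⟨hv₀ i ht, ?_⟩, hsteers⟩
  · obtain ⟨h₀, h₁, -⟩ := hle i t
    refine (norm_add_le _ _).trans ?_
    rw [norm_mul, Complex.norm_real, Real.norm_of_nonneg hδ]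
    linarith [mul_le_mul_of_nonneg_left h₀ hδ]
  · change deriv (fun s => v s i) t + δ * v t i = 0
    rw [hv₀ i ht, testFunctions.eq_zero_of_notMem_Ioo (hv' i) fun h => h.2.not_ge ht, mul_zero,
      add_zero]

theorem exists_memLp (h : SmoothlySteerable A B β γ T C Φ) (hβ : ∀ t, β t = Real.exp (-δ * t))
    (hδ : 0 ≤ δ) (hT : 0 ≤ T) (hC : 0 ≤ C) (y₀ : Complexification H) :
    ∃ v w : ℝ → Fin M → ℂ,
      ContinuousOn v (Ico 0 T) ∧ ContinuousOn w (Ico 0 T) ∧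
      (∀ i, MemLp (fun t => w t i) 2 (volume.restrict (Ioo 0 T))) ∧
      (∀ i, ∀ t ∈ Ico 0 T, v t i = -∫ s in t..T, (β (t - s) : ℂ) * w s i) ∧
      (∀ i, ∫ t in (0 : ℝ)..T, ‖w t i‖ ^ 2 ≤ (C + T * ((1 + δ) * C) ^ 2) * ‖y₀‖ ^ 2) ∧
      (∀ i, ∀ t, T ≤ t → v t i = 0 ∧ w t i = 0) ∧
      Steers A B β γ (C + T * ((1 + δ) * C) ^ 2) y₀ (control Φ v) := by
  obtain ⟨v, w, hv, hw, hvw, hle, hzero, hsteers⟩ := h.exists_eq_neg_integral hβ hδ y₀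
  have hwc (i : Fin M) : Continuous fun t => w t i := (continuous_apply i).comp hw
  refine ⟨v, w, hv.continuousOn, hw.continuousOn, fun i => MemLp.of_bound
    (hwc i).aestronglyMeasurable _ (.of_forall (hle i)), fun i t _ => hvw i t, fun i => ?_, hzero,
    hsteers.mono (le_add_of_nonneg_right (by positivity))⟩
  calc ∫ t in (0 : ℝ)..T, ‖w t i‖ ^ 2
    _ ≤ ∫ _ in (0 : ℝ)..T, ((1 + δ) * C * ‖y₀‖) ^ 2 :=
      intervalIntegral.integral_mono_on hT (((hwc i).norm.pow 2).intervalIntegrable _ _)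
        intervalIntegrable_const fun t _ => pow_le_pow_left₀ (norm_nonneg _) (hle i t) 2
    _ = T * ((1 + δ) * C) ^ 2 * ‖y₀‖ ^ 2 := by
      rw [intervalIntegral.integral_const, smul_eq_mul]
      ring
    _ ≤ (C + T * ((1 + δ) * C) ^ 2) * ‖y₀‖ ^ 2 := by
      gcongr
      exact le_add_of_nonneg_left hC

theorem exists_contDiffOn (h : SmoothlySteerable A B β γ T C Φ) (hγ : 0 ≤ γ) (hT : 0 ≤ T)
    (hC : 0 ≤ C) (y₀ : Complexification H) :
    ∃ v : ℝ → Fin M → ℂ,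
      (∀ j, ContDiffOn ℝ 2 (fun t => v t j) (Ici 0)) ∧
      (∀ j t, ‖v t j‖ + ‖deriv (fun s => v s j) t‖ + ‖deriv (deriv fun s => v s j) t‖ ≤
        3 * C * Real.exp (γ * T) * Real.exp (-γ * t) * ‖y₀‖) ∧
      Steers A B β γ (3 * C * Real.exp (γ * T)) y₀ (control Φ v) := by
  obtain ⟨v, hv, hle, hsteers⟩ := h y₀
  have hexp : 1 ≤ Real.exp (γ * T) := Real.one_le_exp (by positivity)
  refine ⟨v, fun j => (contDiff_infty.1 (testFunctions.contDiff (hv j)) 2).contDiffOn,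
    fun j t => ?_, hsteers.mono (by nlinarith)⟩
  rcases le_or_gt T t with ht | ht
  · have hzero {θ : ℝ → ℂ} (hθ : θ ∈ testFunctions T) : θ t = 0 :=
      testFunctions.eq_zero_of_notMem_Ioo hθ fun h => h.2.not_ge ht
    have hv' := testFunctions.deriv_mem (hv j)
    rw [hzero hv', hzero (testFunctions.deriv_mem hv'), hzero (hv j), norm_zero, add_zero, add_zero]
    positivity
  · obtain ⟨h₀, h₁, h₂⟩ := hle j t
    have hone : 1 ≤ Real.exp (γ * T) * Real.exp (-γ * t) := by
      rw [← Real.exp_add]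
      exact Real.one_le_exp (by nlinarith)
    calc _ ≤ 3 * C * ‖y₀‖ * 1 := by linarith
      _ ≤ 3 * C * ‖y₀‖ * (Real.exp (γ * T) * Real.exp (-γ * t)) := by gcongr
      _ = _ := by ring

end SmoothlySteerable

theorem BlockRankCondition.exists_smoothlySteerable [CompleteSpace H] {lam : ℕ → ℝ} {φ φs : ℕ → H}
    {N : ℕ} (hB : BlockRankCondition B lam φs N M) (hφ : IsEigenSystem A lam φ)
    (hA : IsSelfAdjoint A) (hpos : PositiveDefinite A) (hcpt : HasCompactResolvent A) (hδ : 0 < δ)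
    (hβ : ∀ t, β t = Real.exp (-δ * t))
    (hδ_ne : ∀ j, δ ≠ lam j + 2 * √(lam j) ∧ δ ≠ lam j - 2 * √(lam j)) (hγ : 0 < γ)
    (hN : ∀ n, N ≤ n → γ ≤ (muMinus δ (lam n)).re) (hφs : ∀ j < N, φs j = φ j) (hT : 0 < T) :
    ∃ C, 0 < C ∧ SmoothlySteerable A B β γ T C fun i : Fin M => φs i := by
  have hlam (n : ℕ) : 0 < lam n := (hφ.eigen n).pos hpos (hφ.orthonormal.ne_zero n)
  obtain ⟨C, hC₀, hC⟩ := exists_isCoefBound hδ (hφ.tendsto_atTop hcpt)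
  refine PIDE.exists_smoothlySteerable (e := ((↑) : Fin N → ℕ))
    (hφ.isDiagonalIn_basis hA hcpt).mapPMap hβ hδ hγ hT hlam
    (fun n => muPlus_ne_muMinus (hlam n) (hδ_ne n)) hC₀ hC (fun n => ?_) fun j => ?_
  · rw [Fin.range_val]
    exact (le_or_gt N n).imp_left (hN n)
  · obtain ⟨U, hU⟩ := hB.exists_mulVec_eq j
    have hmat (k : Fin N) (i : Fin M) :
        ⟪ofReal (φ k), ofReal (B (φs i))⟫_ℂ = matC B φs N M k i := by
      rw [inner_ofReal, matC, Matrix.of_apply, hφs k k.2, real_inner_comm]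
      simp [ofReal, Complex.ext_iff]
    refine ⟨U, fun k hk => (Finset.sum_congr rfl fun i _ => ?_).trans (hU k hk)⟩
    rw [complexifyBasis_apply, hφ.coe_basis, hmat, mul_comm]

end Controls

end PIDE

end

theorem mainTheorem4_general {H : Type*} [NormedAddCommGroup H] [InnerProductSpace ℝ H]
    [CompleteSpace H] (A : H →ₗ.[ℝ] H) (hA : IsSelfAdjoint A) (hpos : PositiveDefinite A)
    (hcpt : HasCompactResolvent A) (lam : ℕ → ℝ) (φ : ℕ → H) (hφ : IsEigenSystem A lam φ)
    (B : H →L[ℝ] H) (δ : ℝ) (hδ : 0 < δ) (β : ℝ → ℝ) (hβ : ∀ t, HasDerivAt β (-δ * β t) t)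
    (hβ0 : β 0 = 1) (hδ_ne : ∀ j, δ ≠ lam j + 2 * √(lam j) ∧ δ ≠ lam j - 2 * √(lam j))
    (γ : ℝ) (hγ : 0 < γ) (hγ' : γ < δ + 1) (N M : ℕ) (hN : N = unstableDim δ γ lam)
    (φs : ℕ → H) (hφs_eig : ∀ j < N, IsEigenpair A (lam j) (φs j))
    (hφs : ∀ i j, i < N → j < N → ⟪φ i, φs j⟫_ℝ = if i = j then 1 else 0)
    (hB : BlockRankCondition B lam φs N M) :
    (∃ C : ℝ, 0 < C ∧ ∀ y₀ : Complexification H, ∃ v : ℝ → Fin M → ℂ,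
      ContinuousOn v (Set.Ici 0) ∧
      Steers A B β γ C y₀ (control (fun i : Fin M => φs i) v)) ∧
    (∀ T : ℝ, 0 < T → ∃ C : ℝ, 0 < C ∧ ∀ y₀ : Complexification H,
      ∃ v w : ℝ → Fin M → ℂ,
        ContinuousOn v (Set.Ico 0 T) ∧ ContinuousOn w (Set.Ico 0 T) ∧
        (∀ i, MeasureTheory.MemLp (fun t => w t i) 2
          (MeasureTheory.volume.restrict (Set.Ioo 0 T))) ∧
        (∀ i, ∀ t ∈ Set.Ico 0 T, v t i = -∫ s in t..T, (β (t - s) : ℂ) * w s i) ∧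
        (∀ i, ∫ t in (0 : ℝ)..T, ‖w t i‖ ^ 2 ≤ C * ‖y₀‖ ^ 2) ∧
        (∀ i, ∀ t, T ≤ t → v t i = 0 ∧ w t i = 0) ∧
        Steers A B β γ C y₀ (control (fun i : Fin M => φs i) v)) ∧
    (∃ C : ℝ, 0 < C ∧ ∀ y₀ : Complexification H, ∃ v : ℝ → Fin M → ℂ,
      (∀ j, ContDiffOn ℝ 2 (fun t => v t j) (Set.Ici 0)) ∧
      (∀ j, ∀ t : ℝ, 0 < t →
        ‖v t j‖ + ‖deriv (fun s => v s j) t‖ + ‖deriv (deriv fun s => v s j) t‖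
          ≤ C * Real.exp (-γ * t) * ‖y₀‖) ∧
      Steers A B β γ C y₀ (control (fun i : Fin M => φs i) v)) := by
  subst hN
  have hlam := hφ.tendsto_atTop hcpt
  have hexp := eq_exp_of_hasDerivAt hβ hβ0
  have hstable (n : ℕ) (hn : unstableDim δ γ lam ≤ n) : γ ≤ (muMinus δ (lam n)).re :=
    (lt_muMinus_re_of_unstableDim_le hδ hγ' hlam hn).le
  have heq (j : ℕ) (hj : j < unstableDim δ γ lam) : φs j = φ j :=
    hφ.eq_of_biorthogonal hA hcpt (fun _ _ hi h => lt_unstableDim_of_eq hδ hγ' hlam hφ.mono hi h)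
      hφs_eig hφs hj
  have hsteer (T : ℝ) (hT : 0 < T) :
      ∃ C, 0 < C ∧ SmoothlySteerable A B β γ T C fun i : Fin M => φs i :=
    hB.exists_smoothlySteerable hφ hA hpos hcpt hδ hexp hδ_ne hγ hstable heq hT
  obtain ⟨C, hC, h⟩ := hsteer 1 one_pos
  refine ⟨⟨C, hC, h.exists_continuousOn⟩, fun T hT => ?_,
    3 * C * Real.exp (γ * 1), by positivity, fun y₀ => ?_⟩
  · obtain ⟨C', hC', h'⟩ := hsteer T hT
    exact ⟨C' + T * ((1 + δ) * C') ^ 2, by positivity, h'.exists_memLp hexp hδ.le hT.le hC'.le⟩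
  · obtain ⟨v, hv, hle, hsteers⟩ := h.exists_contDiffOn hγ.le zero_le_one hC.le y₀
    exact ⟨v, hv, fun j t _ => hle j t, hsteers⟩

theorem mainTheorem4
    {H : Type*} [NormedAddCommGroup H] [InnerProductSpace ℝ H] [CompleteSpace H]
    (A : H →ₗ.[ℝ] H) (hA_dense : Dense (A.domain : Set H)) (hA_closed : A.IsClosed)
    (hA_sa : IsSelfAdjoint A) (hA_pos : PositiveDefinite A) (hA_cpt : HasCompactResolvent A)
    (lam : ℕ → ℝ) (φ : ℕ → H) (hφ : IsEigenSystem A lam φ)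
    (B : H →L[ℝ] H)
    (δ : ℝ) (hδ : 0 < δ)
    (β : ℝ → ℝ) (hβ : ∀ t : ℝ, HasDerivAt β (-δ * β t) t) (hβ0 : β 0 = 1)
    -- standing assumptions: no double roots, and no coincidences `μ_j^+ = μ_m^-`
    (hδ_ne : ∀ j, δ ≠ lam j + 2 * Real.sqrt (lam j) ∧ δ ≠ lam j - 2 * Real.sqrt (lam j))
    (h_sep : ∀ j m, j ≠ m → muPlus δ (lam j) ≠ muMinus δ (lam m))
    (γ : ℝ) (hγ : 0 < γ) (hγ' : γ < δ + 1)
    (N M : ℕ) (hN : N = unstableDim δ γ lam) (hM : M = maxMult lam N)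
    -- a system of eigenfunctions biorthogonal to the first `N` ones
    (φs : ℕ → H) (hφs_eig : ∀ j, j < N → IsEigenpair A (lam j) (φs j))
    (hφs : ∀ i j, i < N → j < N → inner ℝ (φ i) (φs j) = if i = j then (1 : ℝ) else 0)
    (h_semisimple : ∀ j, j < N →
      SemisimpleAt (matP δ lam N) (-muPlus δ (lam j)) ∧
      SemisimpleAt (matP δ lam N) (-muMinus δ (lam j)))
    -- diagonalization of `P_{2N}`, and the rank condition
    (R : Matrix (Fin N ⊕ Fin N) (Fin N ⊕ Fin N) ℂ) (hR : IsUnit R)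
    (hRP : matP δ lam N = R⁻¹ * matD δ lam N * R)
    (h_rank : RankCondition B lam φs N M R) :
    -- a controller of the form `u = ∑ i, v_i φ_i^*` stabilizes the system exponentially
    (∃ C : ℝ, 0 < C ∧ ∀ y₀ : Complexification H, ∃ v : ℝ → Fin M → ℂ,
      ContinuousOn v (Set.Ici 0) ∧
      Steers A B β γ C y₀ (control (fun i : Fin M => φs i) v)) ∧
    -- it can be chosen to vanish after a given time `T`
    (∀ T : ℝ, 0 < T → ∃ C : ℝ, 0 < C ∧ ∀ y₀ : Complexification H,
      ∃ v w : ℝ → Fin M → ℂ,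
        ContinuousOn v (Set.Ico 0 T) ∧ ContinuousOn w (Set.Ico 0 T) ∧
        (∀ i, MeasureTheory.MemLp (fun t => w t i) 2
          (MeasureTheory.volume.restrict (Set.Ioo 0 T))) ∧
        (∀ i, ∀ t ∈ Set.Ico 0 T, v t i = -∫ s in t..T, (β (t - s) : ℂ) * w s i) ∧
        (∀ i, ∫ t in (0 : ℝ)..T, ‖w t i‖ ^ 2 ≤ C * ‖y₀‖ ^ 2) ∧
        (∀ i, ∀ t, T ≤ t → v t i = 0 ∧ w t i = 0) ∧
        Steers A B β γ C y₀ (control (fun i : Fin M => φs i) v)) ∧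
    -- it can also be chosen of class `C²` on `[0,∞)` with exponential decay
    (∃ C : ℝ, 0 < C ∧ ∀ y₀ : Complexification H, ∃ v : ℝ → Fin M → ℂ,
      (∀ j, ContDiffOn ℝ 2 (fun t => v t j) (Set.Ici 0)) ∧
      (∀ j, ∀ t : ℝ, 0 < t →
        ‖v t j‖ + ‖deriv (fun s => v s j) t‖ + ‖deriv (deriv fun s => v s j) t‖
          ≤ C * Real.exp (-γ * t) * ‖y₀‖) ∧
      Steers A B β γ C y₀ (control (fun i : Fin M => φs i) v)) :=
  mainTheorem4_general A hA_sa hA_pos hA_cpt lam φ hφ B δ hδ β hβ hβ0 hδ_ne γ hγ hγ' N M hN φs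
    hφs_eig hφs (h_rank.blockRankCondition hδ hR hRP)
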